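/- Let $|\cdot|$ be a norm on $\mathbb{R}^d$ and let $\boldsymbol X=(\boldsymbol X_j)_{j\in\mathbb Z}$ be a stationary regularly varying $\mathbb R^d$-valued time series: for all integers $s\le t$ there is a non-zero Radon measure $\nu_{s,t}$ on $(\mathbb R^d)^{[s,t]}\setminus\{\boldsymbol 0\}$ such that $P(u^{-1}(\boldsymbol X_s,\dots,\boldsymbol X_t)\in\cdot)/P(|\boldsymbol X_0|>u)$ converges vaguely to $\nu_{s,t}$ as $u\to\infty$. Let $\nu$ be its tail measure, i.e. the Borel measure on $(\mathbb R^d)^{\mathbb Z}$ with $\nu(\{\boldsymbol 0\})=0$ whose image under the projection to the coordinates $s,\dots,t$ is $\nu_{s,t}$ on $(\mathbb R^d)^{[s,t]}\setminus\{\boldsymbol 0\}$ for all $s\le t$. Let $\alpha>0$ and let $\boldsymbol Y=(\boldsymbol Y_j)_{j\in\mathbb Z}$ be the tail index and the tail process of $\boldsymbol X$: $P(|\boldsymbol Y_0|>y)=y^{-\alpha}$ for $y\ge1$, and for all $s\le t$ the law of $u^{-1}(\boldsymbol X_s,\dots,\boldsymbol X_t)$ conditional on $|\boldsymbol X_0|>u$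 converges weakly to the law of $(\boldsymbol Y_s,\dots,\boldsymbol Y_t)$ as $u\to\infty$. Let $\ell_0=\{\boldsymbol x\in(\mathbb R^d)^{\mathbb Z}:\lim_{|j|\to\infty}|\boldsymbol x_j|=0\}$, and let $\tilde\ell_0$ be the space of equivalence classes of $\ell_0$ under shifts of the index, with the metric $\tilde d(\tilde{\boldsymbol x},\tilde{\boldsymbol y})=\inf\{\sup_j|\boldsymbol x_j-\boldsymbol y_j|:\boldsymbol x\in\tilde{\boldsymbol x},\boldsymbol y\in\tilde{\boldsymbol y}\}$. Write $\boldsymbol x^*=\sup_{j}|\boldsymbol x_j|$. Finite vectors are completed by zeros to sequences, and elements of $\ell_0$ are identified with their classes in $\tilde\ell_0$. Let $\mathcal M_0$ be the set of Borel measures $\mu$ on $\tilde\ell_0\setminus\{\boldsymbol 0\}$ that are finite on every Borel set contained in $\{\tilde{\boldsymbol x}:\tilde{\boldsymbol x}^*>\epsilon\}$ for some $\epsilon>0$; $\mu_n\to\mu$ in $\mathcal M_0$ means that $\mu_n,\mu\in\mathcal M_0$ and $\int f\,d\mu_n\to\int f\,d\mu$ for every bounded continuous $f$ that vanishes outside such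 a set. Assume that $\nu$ is supported on $\ell_0$. Let $\vartheta=P(\sup_{j\ge1}|\boldsymbol Y_j|\le1)$, let $\boldsymbol Q$ have the law of $(\boldsymbol Y^*)^{-1}\boldsymbol Y$ conditional on $\sup_{j\le-1}|\boldsymbol Y_j|\le1$, and let $\nu^*$ be the measure with $\nu^*(H)=\vartheta\int_0^\infty E[H(r\boldsymbol Q)]\,\alpha r^{-\alpha-1}\,dr$ for measurable $H\ge0$. Let $c_n\in\mathbb R$ and $r_n\in\mathbb N$ satisfy $c_n\to\infty$, $r_n\to\infty$ and $r_nP(|\boldsymbol X_0|>c_n)\to0$. Write $\boldsymbol X_{1,r_n}=(\boldsymbol X_1,\dots,\boldsymbol X_{r_n})$, $\boldsymbol X^*_{1,r_n}=\max_{1\le i\le r_n}|\boldsymbol X_i|$ and $$\nu_{n,r_n}=\frac{P(c_n^{-1}\boldsymbol X_{1,r_n}\in\cdot)}{r_nP(|\boldsymbol X_0|>c_n)}.$$ Then $\nu_{n,r_n}\to\nu^*$ in $\mathcal M_0$ if and only if for every $u>0$, as $n\to\infty$, $$\frac{P(\boldsymbol X^*_{1,r_n}>c_nu)}{r_nP(|\boldsymbol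 X_0|>c_n)}\longrightarrow\vartheta u^{-\alpha}$$ and $$\mathcal L\big((\boldsymbol X^*_{1,r_n})^{-1}\boldsymbol X_{1,r_n}\,\big|\,\boldsymbol X^*_{1,r_n}>c_nu\big)\longrightarrow\mathcal L(\boldsymbol Q)\quad\text{weakly in }\tilde\ell_0.$$ -/

import Mathlib

open Filter Topology MeasureTheory ProbabilityTheory
open scoped ZeroAtInfty BoundedContinuousFunction ENNReal

noncomputable section

namespace TailProcess

/-! ### Sequences vanishing at infinity, up to a shift

`C₀(ℤ, E)` with its supremum norm is the space of sequences `x : ℤ → E` such that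
`‖x j‖ → 0` as `|j| → ∞`. -/

section ShiftClasses

variable (E : Type*) [NormedAddCommGroup E]

/-- Two sequences are shift equivalent if one of them is a shift of the other. -/
def shiftSetoid : Setoid C₀(ℤ, E) where
  r x y := ∃ k : ℤ, ∀ j, y j = x (j - k)
  iseqv :=
    { refl := fun x => ⟨0, fun j => by simp⟩
      symm := by
        rintro x y ⟨k, hk⟩
        refine ⟨-k, fun j => ?_⟩
        rw [hk]
        congr 1
        ring
      trans := by
        rintro x y z ⟨k, hk⟩ ⟨l, hl⟩
        refine ⟨l + k, fun j => ?_⟩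
        rw [hl, hk]
        congr 1
        ring }

/-- The space of shift equivalence classes of sequences vanishing at infinity. -/
def ShiftClass : Type _ := Quotient (shiftSetoid E)

variable {E}

/-- The class of a sequence vanishing at infinity. -/
def ShiftClass.mk (x : C₀(ℤ, E)) : ShiftClass E := Quotient.mk (shiftSetoid E) x

/-- The shift `(B ^ k x) j = x (j - k)`. -/
def shift (k : ℤ) (x : C₀(ℤ, E)) : C₀(ℤ, E) :=
  x.comp (Homeomorph.subRight k).toCocompactMap

theorem shift_apply (k : ℤ) (x : C₀(ℤ, E)) (j : ℤ) : shift k x j = x (j - k) := rfl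

theorem ShiftClass.mk_eq_mk {x y : C₀(ℤ, E)} :
    ShiftClass.mk x = ShiftClass.mk y ↔ ∃ k : ℤ, y = shift k x := by
  refine Quotient.eq.trans ⟨?_, ?_⟩
  · rintro ⟨k, hk⟩
    exact ⟨k, ZeroAtInftyContinuousMap.ext fun j => hk j⟩
  · rintro ⟨k, rfl⟩
    exact ⟨k, fun j => rfl⟩

theorem ShiftClass.mk_shift (k : ℤ) (x : C₀(ℤ, E)) :
    ShiftClass.mk (shift k x) = ShiftClass.mk x :=
  (ShiftClass.mk_eq_mk.2 ⟨k, rfl⟩).symm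

theorem ShiftClass.exists_rep (x : ShiftClass E) : ∃ a, ShiftClass.mk a = x :=
  Quotient.exists_rep x

theorem dist_le_iff {x y : C₀(ℤ, E)} {C : ℝ} (hC : 0 ≤ C) :
    dist x y ≤ C ↔ ∀ j, dist (x j) (y j) ≤ C := by
  rw [← ZeroAtInftyContinuousMap.dist_toBCF_eq_dist]
  exact BoundedContinuousFunction.dist_le hC

theorem dist_apply_le (x y : C₀(ℤ, E)) (j : ℤ) : dist (x j) (y j) ≤ dist x y :=
  (dist_le_iff dist_nonneg).1 le_rfl j

theorem dist_shift (k : ℤ) (x y : C₀(ℤ, E)) : dist (shift k x) (shift k y) = dist x y := by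
  apply le_antisymm
  · exact (dist_le_iff dist_nonneg).2 fun j => dist_apply_le x y (j - k)
  · refine (dist_le_iff dist_nonneg).2 fun j => ?_
    have h := dist_apply_le (shift k x) (shift k y) (j + k)
    simpa [shift_apply] using h

theorem dist_shift_shift (k l : ℤ) (x y : C₀(ℤ, E)) :
    dist (shift k x) (shift l y) = dist x (shift (l - k) y) := by
  have : shift l y = shift k (shift (l - k) y) := by
    ext j
    simp only [shift_apply]
    congr 1
    ring
  rw [this, dist_shift]

theorem norm_shift (k : ℤ) (x : C₀(ℤ, E)) : ‖shift k x‖ = ‖x‖ := by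
  have h : shift k (0 : C₀(ℤ, E)) = 0 := rfl
  rw [← dist_zero_right, ← dist_zero_right, ← h, dist_shift, h]

/-- The infimum of the supremum distances between representatives of two classes. -/
instance : Dist (ShiftClass E) where
  dist x y := sInf {δ : ℝ | ∃ a b, ShiftClass.mk a = x ∧ ShiftClass.mk b = y ∧ δ = dist a b}

theorem ShiftClass.dist_def (x y : ShiftClass E) : dist x y =
    sInf {δ : ℝ | ∃ a b, ShiftClass.mk a = x ∧ ShiftClass.mk b = y ∧ δ = dist a b} := rfl

theorem ShiftClass.dist_le (a b : C₀(ℤ, E)) :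
    dist (ShiftClass.mk a) (ShiftClass.mk b) ≤ dist a b :=
  csInf_le ⟨0, by rintro _ ⟨_, _, _, _, rfl⟩; exact dist_nonneg⟩ ⟨a, b, rfl, rfl, rfl⟩

theorem ShiftClass.exists_dist_lt (a b : C₀(ℤ, E)) {δ : ℝ}
    (h : dist (ShiftClass.mk a) (ShiftClass.mk b) < δ) : ∃ k, dist a (shift k b) < δ := by
  rw [ShiftClass.dist_def] at h
  obtain ⟨_, ⟨a', b', ha, hb, rfl⟩, hlt⟩ := exists_lt_of_csInf_lt
    (by exact ⟨_, a, b, rfl, rfl, rfl⟩) h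
  obtain ⟨k, rfl⟩ := ShiftClass.mk_eq_mk.1 ha.symm
  obtain ⟨l, rfl⟩ := ShiftClass.mk_eq_mk.1 hb.symm
  rw [dist_shift_shift] at hlt
  exact ⟨_, hlt⟩

theorem ShiftClass.dist_nonneg' (x y : ShiftClass E) : 0 ≤ dist x y :=
  Real.sInf_nonneg (by rintro _ ⟨_, _, _, _, rfl⟩; exact dist_nonneg)

theorem ShiftClass.dist_triangle' (x y z : ShiftClass E) : dist x z ≤ dist x y + dist y z := by
  obtain ⟨a, rfl⟩ := x.exists_rep
  obtain ⟨b, rfl⟩ := y.exists_rep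
  obtain ⟨c, rfl⟩ := z.exists_rep
  refine le_of_forall_pos_lt_add fun ε hε => ?_
  obtain ⟨k, hk⟩ := ShiftClass.exists_dist_lt a b (lt_add_of_pos_right _ (half_pos hε))
  obtain ⟨l, hl⟩ := ShiftClass.exists_dist_lt b c (lt_add_of_pos_right _ (half_pos hε))
  have h1 : dist (ShiftClass.mk a) (ShiftClass.mk c) ≤ dist a (shift (k + l) c) := by
    rw [← ShiftClass.mk_shift (k + l) c]
    exact ShiftClass.dist_le _ _
  have h2 : dist (shift k b) (shift (k + l) c) = dist b (shift l c) := by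
    rw [dist_shift_shift]
    congr 2
    ring
  have h3 := dist_triangle a (shift k b) (shift (k + l) c)
  linarith

theorem ShiftClass.eq_of_dist_eq_zero' (x y : ShiftClass E) (h : dist x y = 0) : x = y := by
  obtain ⟨a, rfl⟩ := x.exists_rep
  obtain ⟨b, rfl⟩ := y.exists_rep
  by_cases ha : a = 0
  · subst ha
    have hb : ‖b‖ ≤ 0 := by
      refine le_of_forall_pos_lt_add fun ε hε => ?_
      obtain ⟨k, hk⟩ := ShiftClass.exists_dist_lt 0 b (h.trans_lt hε)
      rwa [dist_zero_left, norm_shift, ← zero_add ε] at hk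
    rw [norm_le_zero_iff.1 hb]
  -- fix a non-zero coordinate of `a`: only finitely many shifts of `b` are close to `a` there
  obtain ⟨i, hi⟩ : ∃ i, a i ≠ 0 := by
    by_contra! hc
    exact ha (ZeroAtInftyContinuousMap.ext hc)
  have hpos : 0 < ‖a i‖ := norm_pos_iff.2 hi
  have hfin : {j : ℤ | ‖a i‖ / 2 ≤ ‖b j‖}.Finite := by
    have h0 : Tendsto (fun j => ‖b j‖) (cocompact ℤ) (𝓝 0) := by
      simpa using (zero_at_infty b).norm
    rw [cocompact_eq_cofinite] at h0
    have := h0.eventually (gt_mem_nhds (half_pos hpos))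
    rw [eventually_cofinite] at this
    simpa using this
  have hfin' : {k : ℤ | dist a (shift k b) < ‖a i‖ / 2}.Finite := by
    refine (hfin.image fun j => i - j).subset fun k hk => ⟨i - k, ?_, by ring⟩
    have h1 := (dist_apply_le a (shift k b) i).trans_lt hk
    rw [shift_apply, dist_eq_norm] at h1
    have h2 := norm_sub_norm_le (a i) (b (i - k))
    change ‖a i‖ / 2 ≤ ‖b (i - k)‖
    linarith
  by_contra hne
  have hd : ∀ k, 0 < dist a (shift k b) := fun k => dist_pos.2 fun hk =>
    hne (by rw [hk, ShiftClass.mk_shift])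
  obtain ⟨k₀, hk₀⟩ := ShiftClass.exists_dist_lt a b (h.trans_lt (half_pos hpos))
  obtain ⟨m, hm, hmin⟩ := hfin'.exists_minimalFor (fun k => dist a (shift k b)) _ ⟨k₀, hk₀⟩
  obtain ⟨k₁, hk₁⟩ := ShiftClass.exists_dist_lt a b (h.trans_lt (hd m))
  exact absurd (hmin (hk₁.trans hm) hk₁.le) (not_le.2 hk₁)

instance : MetricSpace (ShiftClass E) where
  dist_self x := by
    obtain ⟨a, rfl⟩ := x.exists_rep
    refine le_antisymm ?_ (ShiftClass.dist_nonneg' _ _)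
    simpa using ShiftClass.dist_le a a
  dist_comm x y := by
    rw [ShiftClass.dist_def, ShiftClass.dist_def]
    congr 1
    ext δ
    constructor
    · rintro ⟨a, b, ha, hb, rfl⟩
      exact ⟨b, a, hb, ha, dist_comm _ _⟩
    · rintro ⟨a, b, ha, hb, rfl⟩
      exact ⟨b, a, hb, ha, dist_comm _ _⟩
  dist_triangle := ShiftClass.dist_triangle'
  eq_of_dist_eq_zero := ShiftClass.eq_of_dist_eq_zero' _ _

instance : MeasurableSpace (ShiftClass E) := borel _

instance : BorelSpace (ShiftClass E) := ⟨rfl⟩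

/-- The maximum of the norms of the coordinates, which is the same for all representatives. -/
def ShiftClass.maxNorm : ShiftClass E → ℝ :=
  Quotient.lift (s := shiftSetoid E) (fun x => ‖x‖) (by
    rintro x y ⟨k, hk⟩
    have : y = shift k x := ZeroAtInftyContinuousMap.ext hk
    rw [this, norm_shift])

/-- The sequences `x : ℤ → E` with `‖x j‖ → 0` as `|j| → ∞`. -/
def ellZero (E : Type*) [NormedAddCommGroup E] : Set (ℤ → E) :=
  {x | Tendsto (fun j => ‖x j‖) cofinite (𝓝 0)}

open Classical in
/-- The shift class of a sequence that vanishes at infinity.  Other sequences are sent to the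
class of the zero sequence; below, they form a null set. -/
def toShiftClass (x : ℤ → E) : ShiftClass E :=
  if h : x ∈ ellZero E then
    ShiftClass.mk
      { toFun := x
        continuous_toFun := continuous_of_discreteTopology
        zero_at_infty' := by
          rw [cocompact_eq_cofinite]
          exact tendsto_zero_iff_norm_tendsto_zero.2 h }
  else ShiftClass.mk 0

/-! ### Convergence of measures -/

/-- A measure on shift classes is boundedly finite (on the complement of the zero class) if it
is finite on all Borel sets that are bounded away from the zero class. -/
def BoundedlyFinite (μ : Measure (ShiftClass E)) : Prop :=
  ∀ A : Set (ShiftClass E), MeasurableSet A → (∃ ε > 0, ∀ x ∈ A, ε < x.maxNorm) → μ A < ∞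

/-- Convergence in the space of boundedly finite measures on non-zero shift classes: the
integrals of bounded continuous functions with support bounded away from the zero class
converge.  (Such functions on the non-zero classes extend continuously by the value zero.) -/
def TendstoMZero (μs : ℕ → Measure (ShiftClass E)) (μ : Measure (ShiftClass E)) : Prop :=
  (∀ n, BoundedlyFinite (μs n)) ∧ BoundedlyFinite μ ∧
    ∀ f : ShiftClass E →ᵇ ℝ, (∃ ε > 0, ∀ x, f x ≠ 0 → ε < x.maxNorm) →
      Tendsto (fun n => ∫ x, f x ∂(μs n)) atTop (𝓝 (∫ x, f x ∂μ))

/-- Weak convergence (of probability measures) along a filter. -/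
def TendstoWeakly {S ι : Type*} [TopologicalSpace S] [MeasurableSpace S]
    (μs : ι → Measure S) (l : Filter ι) (μ : Measure S) : Prop :=
  ∀ f : S →ᵇ ℝ, Tendsto (fun i => ∫ x, f x ∂(μs i)) l (𝓝 (∫ x, f x ∂μ))

end ShiftClasses

/-! ### Regular variation, tail measure and tail process -/

section Tail

variable {E : Type*} [NormedAddCommGroup E] [NormedSpace ℝ E] [MeasurableSpace E]
variable {Ω : Type*} [MeasurableSpace Ω]

/-- The canonical projection of a sequence onto its coordinates from `s` to `t`. -/
def window (s t : ℤ) (x : ℤ → E) : Set.Icc s t → E := fun i => x i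

/-- Strict stationarity: the law of the sequence is invariant under shifts of time. -/
def IsStationary (P : Measure Ω) (X : Ω → ℤ → E) : Prop :=
  ∀ k : ℤ, P.map (fun ω j => X ω (j + k)) = P.map X

/-- `μ`, as a measure on the non-zero vectors `(x_s, …, x_t)`, is non-zero and Radon (finite on
compact sets), and `P(u⁻¹ (X_s, …, X_t) ∈ ·) / P(‖X_0‖ > u)` converges vaguely to `μ` on the
non-zero vectors as `u → ∞`.  The test functions are the continuous functions with
compact support in the set of non-zero vectors, extended by zero. -/
structure IsVagueTailLimit (P : Measure Ω) (X : Ω → ℤ → E) (s t : ℤ)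
    (μ : Measure (Set.Icc s t → E)) : Prop where
  ne_zero : μ {0}ᶜ ≠ 0
  radon : ∀ K : Set (Set.Icc s t → E), IsCompact K → 0 ∉ K → μ K < ∞
  tendsto : ∀ f : (Set.Icc s t → E) → ℝ, Continuous f → HasCompactSupport f → 0 ∉ tsupport f →
    Tendsto (fun u : ℝ => (∫ ω, f (u⁻¹ • window s t (X ω)) ∂P) / P.real {ω | u < ‖X ω 0‖})
      atTop (𝓝 (∫ x, f x ∂μ))

/-- The sequence `X` is regularly varying and `ν` is its tail measure: `ν` does not charge the
zero sequence and, for all `s ≤ t`, its projection to the non-zero vectors `(x_s, …, x_t)`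
is the vague limit in the definition of regular variation. -/
structure IsTailMeasure (P : Measure Ω) (X : Ω → ℤ → E) (ν : Measure (ℤ → E)) : Prop where
  zero : ν {0} = 0
  projection : ∀ s t : ℤ, s ≤ t →
    IsVagueTailLimit P X s t ((ν.map (window s t)).restrict {0}ᶜ)

variable {Ω' : Type*} [MeasurableSpace Ω']

/-- `Y` is the tail process of `X`, and `α` is the tail index: `P(‖Y_0‖ > y) = y ^ (-α)` for
`y ≥ 1` and, for all `s ≤ t`, the conditional law of `u⁻¹ (X_s, …, X_t)` given
`‖X_0‖ > u` converges weakly to the law of `(Y_s, …, Y_t)` as `u → ∞`. -/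
structure IsTailProcess (P : Measure Ω) (X : Ω → ℤ → E) (α : ℝ)
    (P' : Measure Ω') (Y : Ω' → ℤ → E) : Prop where
  pareto : ∀ y : ℝ, 1 ≤ y → P'.real {ω | y < ‖Y ω 0‖} = y ^ (-α)
  tendsto : ∀ s t : ℤ, s ≤ t →
    TendstoWeakly
      (fun u : ℝ => (P[|{ω | u < ‖X ω 0‖}]).map (fun ω => u⁻¹ • window s t (X ω)))
      atTop (P'.map (fun ω => window s t (Y ω)))

/-- The maximum `sup_j ‖x_j‖` of a bounded sequence. -/
def seqMax (x : ℤ → E) : ℝ := ⨆ j, ‖x j‖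

/-- The candidate extremal index `P(sup_{j ≥ 1} ‖Y_j‖ ≤ 1)`. -/
def extremalIndex (P' : Measure Ω') (Y : Ω' → ℤ → E) : ℝ :=
  P'.real {ω | ∀ j : ℤ, 1 ≤ j → ‖Y ω j‖ ≤ 1}

/-- The law of the sequence `Q`: the conditional law of `Y / sup_j ‖Y_j‖` given
`sup_{j ≤ -1} ‖Y_j‖ ≤ 1`. -/
def lawQ (P' : Measure Ω') (Y : Ω' → ℤ → E) : Measure (ℤ → E) :=
  (P'[|{ω | ∀ j : ℤ, j ≤ -1 → ‖Y ω j‖ ≤ 1}]).map (fun ω => (seqMax (Y ω))⁻¹ • Y ω)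

/-- The measure `α r ^ (-α - 1) dr` on `(0, ∞)`. -/
def radialMeasure (α : ℝ) : Measure ℝ :=
  (volume.restrict (Set.Ioi 0)).withDensity (fun r => ENNReal.ofReal (α * r ^ (-α - 1)))

/-- The measure `ν*(H) = ϑ ∫_0^∞ E[H(r Q)] α r ^ (-α - 1) dr` on sequences. -/
def nuStar (α : ℝ) (P' : Measure Ω') (Y : Ω' → ℤ → E) : Measure (ℤ → E) :=
  ENNReal.ofReal (extremalIndex P' Y) •
    ((radialMeasure α).prod (lawQ P' Y)).map (fun p => p.1 • p.2)

/-- The block `(x_1, …, x_m)`, completed by zeros to the left and to the right. -/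
def block (m : ℕ) (x : ℤ → E) : ℤ → E := fun j => if 1 ≤ j ∧ j ≤ (m : ℤ) then x j else 0

/-- The measure `P(c⁻¹ (X_1, …, X_m) ∈ ·) / (m P(‖X_0‖ > c))` on shift classes. -/
def clusterMeasure (P : Measure Ω) (X : Ω → ℤ → E) (c : ℝ) (m : ℕ) : Measure (ShiftClass E) :=
  ((m : ℝ≥0∞) * P {ω | c < ‖X ω 0‖})⁻¹ •
    P.map (fun ω => toShiftClass (c⁻¹ • block m (X ω)))

end Tail

end TailProcess

end

open TailProcess

namespace TailProcess

/-! ### The space of shift classes -/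

namespace ShiftClass

section Norm

variable {E : Type*} [NormedAddCommGroup E]

theorem maxNorm_mk (a : C₀(ℤ, E)) : (mk a).maxNorm = ‖a‖ := rfl

theorem abs_maxNorm_sub_le (x y : ShiftClass E) : |x.maxNorm - y.maxNorm| ≤ dist x y := by
  obtain ⟨a, rfl⟩ := x.exists_rep
  obtain ⟨b, rfl⟩ := y.exists_rep
  refine le_of_forall_pos_lt_add fun ε hε => ?_
  obtain ⟨k, hk⟩ := exists_dist_lt a b (lt_add_of_pos_right _ hε)
  rw [maxNorm_mk, maxNorm_mk, ← norm_shift k b]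
  exact (abs_norm_sub_norm_le _ _).trans_lt (by rwa [← dist_eq_norm])

theorem continuous_maxNorm : Continuous (maxNorm : ShiftClass E → ℝ) :=
  (LipschitzWith.of_dist_le_mul (K := 1) fun x y => by
    simpa [Real.dist_eq] using abs_maxNorm_sub_le x y).continuous

theorem measurableSet_lt_maxNorm (u : ℝ) : MeasurableSet {x : ShiftClass E | u < x.maxNorm} :=
  (isOpen_lt continuous_const continuous_maxNorm).measurableSet

end Norm

section SMul

variable {E : Type*} [NormedAddCommGroup E] [NormedSpace ℝ E]

theorem _root_.TailProcess.shift_smul (k : ℤ) (r : ℝ) (x : C₀(ℤ, E)) :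
    shift k (r • x) = r • shift k x := rfl

instance : SMul ℝ (ShiftClass E) where
  smul r := Quotient.map (sa := shiftSetoid E) (sb := shiftSetoid E) (fun x => r • x) (by
    rintro x y ⟨k, hk⟩
    exact ⟨k, fun j => by simp [hk]⟩)

theorem smul_mk (r : ℝ) (a : C₀(ℤ, E)) : r • mk a = mk (r • a) := rfl

theorem smul_smul' (r s : ℝ) (x : ShiftClass E) : r • s • x = (r * s) • x := by
  obtain ⟨a, rfl⟩ := x.exists_rep
  simp only [smul_mk, smul_smul]

theorem one_smul' (x : ShiftClass E) : (1 : ℝ) • x = x := by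
  obtain ⟨a, rfl⟩ := x.exists_rep
  simp only [smul_mk, one_smul]

theorem maxNorm_smul (r : ℝ) (x : ShiftClass E) : (r • x).maxNorm = |r| * x.maxNorm := by
  obtain ⟨a, rfl⟩ := x.exists_rep
  rw [smul_mk, maxNorm_mk, maxNorm_mk, norm_smul, Real.norm_eq_abs]

theorem dist_smul_left_le (r s : ℝ) (x : ShiftClass E) :
    dist (r • x) (s • x) ≤ |r - s| * x.maxNorm := by
  obtain ⟨a, rfl⟩ := x.exists_rep
  refine (dist_le _ _).trans ?_
  rw [dist_eq_norm, ← sub_smul, norm_smul, Real.norm_eq_abs, maxNorm_mk]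

theorem dist_smul_right_le (r : ℝ) (x y : ShiftClass E) :
    dist (r • x) (r • y) ≤ |r| * dist x y := by
  obtain ⟨a, rfl⟩ := x.exists_rep
  obtain ⟨b, rfl⟩ := y.exists_rep
  refine le_of_forall_pos_lt_add fun ε hε => ?_
  have hr : 0 < |r| + 1 := by positivity
  obtain ⟨k, hk⟩ := exists_dist_lt a b (lt_add_of_pos_right _ (div_pos hε hr))
  rw [smul_mk, smul_mk, ← mk_shift k (r • b), shift_smul]
  refine (dist_le _ _).trans_lt ?_
  rw [dist_eq_norm, ← smul_sub, norm_smul, ← dist_eq_norm, Real.norm_eq_abs]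
  calc |r| * dist a (shift k b) ≤ |r| * (dist (mk a) (mk b) + ε / (|r| + 1)) := by gcongr
    _ < |r| * dist (mk a) (mk b) + ε := by
      rw [mul_add]
      gcongr
      rw [mul_div_assoc', div_lt_iff₀ hr]
      nlinarith

instance : ContinuousSMul ℝ (ShiftClass E) where
  continuous_smul := by
    rw [continuous_iff_continuousAt]
    rintro ⟨r, x⟩
    refine tendsto_iff_dist_tendsto_zero.2 ?_
    have h : Tendsto (fun p : ℝ × ShiftClass E => |p.1| * dist p.2 x + |p.1 - r| * x.maxNorm)
        (𝓝 (r, x)) (𝓝 (|r| * dist x x + |r - r| * x.maxNorm)) := by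
      apply Continuous.tendsto' _ _ _ rfl
      fun_prop
    simp only [dist_self, sub_self, abs_zero, mul_zero, zero_mul, add_zero] at h
    refine squeeze_zero (fun _ => dist_nonneg) (fun p => ?_) h
    exact (dist_triangle _ (p.1 • x) _).trans
      (add_le_add (dist_smul_right_le _ _ _) (dist_smul_left_le _ _ _))

/-- The class `x` divided by its maximum, if the latter is at least `u`. -/
noncomputable def normalize (u : ℝ) (x : ShiftClass E) : ShiftClass E := (max x.maxNorm u)⁻¹ • x

theorem continuous_normalize {u : ℝ} (hu : 0 < u) :
    Continuous (normalize u : ShiftClass E → ShiftClass E) := by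
  have h : Continuous fun x : ShiftClass E => (max x.maxNorm u)⁻¹ :=
    (continuous_maxNorm.max continuous_const).inv₀ fun x => (hu.trans_le (le_max_right _ _)).ne'
  exact h.smul continuous_id

theorem normalize_of_le {u : ℝ} {x : ShiftClass E} (h : u ≤ x.maxNorm) :
    normalize u x = x.maxNorm⁻¹ • x := by
  rw [normalize, max_eq_left h]

end SMul

end ShiftClass

/-! ### Sequences and their classes -/

section Sequences

variable {E : Type*} [NormedAddCommGroup E]

theorem norm_eq_seqMax (a : C₀(ℤ, E)) : ‖a‖ = seqMax a := by
  rw [← ZeroAtInftyContinuousMap.norm_toBCF_eq_norm,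
    BoundedContinuousFunction.norm_eq_iSup_norm]
  rfl

theorem exists_toShiftClass_eq {x : ℤ → E} (h : x ∈ ellZero E) :
    ∃ a : C₀(ℤ, E), (a : ℤ → E) = x ∧ toShiftClass x = ShiftClass.mk a := by
  rw [toShiftClass, dif_pos h]
  exact ⟨_, rfl, rfl⟩

theorem toShiftClass_coe (a : C₀(ℤ, E)) : toShiftClass a = ShiftClass.mk a := by
  have h : (a : ℤ → E) ∈ ellZero E := by
    have := zero_at_infty a
    rw [cocompact_eq_cofinite] at this
    exact tendsto_zero_iff_norm_tendsto_zero.1 this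
  rw [toShiftClass, dif_pos h]
  rfl

theorem maxNorm_toShiftClass {x : ℤ → E} (h : x ∈ ellZero E) :
    (toShiftClass x).maxNorm = seqMax x := by
  obtain ⟨a, rfl, ha⟩ := exists_toShiftClass_eq h
  rw [ha, ShiftClass.maxNorm_mk, norm_eq_seqMax]

theorem smul_mem_ellZero [NormedSpace ℝ E] (r : ℝ) {x : ℤ → E} (h : x ∈ ellZero E) :
    r • x ∈ ellZero E := by
  have := Tendsto.const_mul |r| (show Tendsto _ _ _ from h)
  simpa [ellZero, norm_smul] using this

theorem toShiftClass_smul [NormedSpace ℝ E] (r : ℝ) {x : ℤ → E} (h : x ∈ ellZero E) :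
    toShiftClass (r • x) = r • toShiftClass x := by
  obtain ⟨a, rfl, ha⟩ := exists_toShiftClass_eq h
  rw [ha, ShiftClass.smul_mk, ← toShiftClass_coe]
  rfl

theorem seqMax_smul [NormedSpace ℝ E] (r : ℝ) (x : ℤ → E) :
    seqMax (r • x) = |r| * seqMax x := by
  simp only [seqMax, Pi.smul_apply, norm_smul, Real.norm_eq_abs]
  exact (Real.mul_iSup_of_nonneg (abs_nonneg r) _).symm

theorem bddAbove_of_mem_ellZero {x : ℤ → E} (h : x ∈ ellZero E) :
    BddAbove (Set.range fun j => ‖x j‖) := by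
  obtain ⟨a, rfl, -⟩ := exists_toShiftClass_eq h
  exact ⟨‖a‖, by rintro _ ⟨j, rfl⟩; simpa using dist_apply_le a 0 j⟩

theorem norm_le_seqMax {x : ℤ → E} (h : x ∈ ellZero E) (j : ℤ) : ‖x j‖ ≤ seqMax x :=
  le_ciSup (bddAbove_of_mem_ellZero h) j

theorem mem_ellZero_of_finite {x : ℤ → E} (h : {j | x j ≠ 0}.Finite) : x ∈ ellZero E := by
  refine tendsto_nhds_of_eventually_eq ?_
  have := h.eventually_cofinite_notMem
  filter_upwards [this] with j hj
  simpa using hj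

theorem block_mem_ellZero (m : ℕ) (x : ℤ → E) : block m x ∈ ellZero E := by
  refine mem_ellZero_of_finite ((Set.finite_Icc (1 : ℤ) m).subset fun j hj => ?_)
  by_contra h
  exact hj (if_neg h)

open Classical in
/-- The vector `(x_s, …, x_t)`, completed by zeros. -/
noncomputable def extend (s t : ℤ) (x : Set.Icc s t → E) : ℤ → E :=
  fun j => if h : j ∈ Set.Icc s t then x ⟨j, h⟩ else 0

theorem extend_apply_of_mem {s t : ℤ} (x : Set.Icc s t → E) {j : ℤ} (h : j ∈ Set.Icc s t) :
    extend s t x j = x ⟨j, h⟩ := dif_pos h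

theorem extend_apply_of_notMem {s t : ℤ} (x : Set.Icc s t → E) {j : ℤ} (h : j ∉ Set.Icc s t) :
    extend s t x j = 0 := dif_neg h

theorem extend_mem_ellZero (s t : ℤ) (x : Set.Icc s t → E) : extend s t x ∈ ellZero E := by
  refine mem_ellZero_of_finite ((Set.finite_Icc s t).subset fun j hj => ?_)
  by_contra h
  exact hj (extend_apply_of_notMem x h)

theorem continuous_extend (s t : ℤ) : Continuous (extend (E := E) s t) := by
  refine continuous_pi fun j => ?_
  by_cases h : j ∈ Set.Icc s t
  · simp only [extend_apply_of_mem _ h]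
    fun_prop
  · simp only [extend_apply_of_notMem _ h]
    fun_prop

theorem dist_toShiftClass_le {x y : ℤ → E} (hx : x ∈ ellZero E) (hy : y ∈ ellZero E) {C : ℝ}
    (hC : 0 ≤ C) (h : ∀ j, dist (x j) (y j) ≤ C) : dist (toShiftClass x) (toShiftClass y) ≤ C := by
  obtain ⟨a, rfl, ha⟩ := exists_toShiftClass_eq hx
  obtain ⟨b, rfl, hb⟩ := exists_toShiftClass_eq hy
  rw [ha, hb]
  exact (ShiftClass.dist_le a b).trans ((dist_le_iff hC).2 h)

theorem continuous_toShiftClass_extend (s t : ℤ) :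
    Continuous fun x : Set.Icc s t → E => toShiftClass (extend s t x) := by
  refine (LipschitzWith.of_dist_le_mul (K := 1) fun x y => ?_).continuous
  rw [NNReal.coe_one, one_mul]
  refine dist_toShiftClass_le (extend_mem_ellZero s t x) (extend_mem_ellZero s t y)
    dist_nonneg fun j => ?_
  by_cases h : j ∈ Set.Icc s t
  · rw [extend_apply_of_mem _ h, extend_apply_of_mem _ h]
    exact dist_le_pi_dist x y _
  · rw [extend_apply_of_notMem _ h, extend_apply_of_notMem _ h, dist_self]
    exact dist_nonneg

theorem tendsto_toShiftClass_truncate {x : ℤ → E} (hx : x ∈ ellZero E) :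
    Tendsto (fun n : ℕ => toShiftClass (extend (-n : ℤ) n (window (-n : ℤ) n x))) atTop
      (𝓝 (toShiftClass x)) := by
  rw [Metric.tendsto_atTop]
  intro ε hε
  have h0 : ∀ᶠ j in cofinite, ‖x j‖ < ε / 2 :=
    (show Tendsto _ _ _ from hx).eventually (gt_mem_nhds (half_pos hε))
  rw [eventually_cofinite] at h0
  obtain ⟨M, hM⟩ := (h0.image Int.natAbs).bddAbove
  refine ⟨M, fun n hn => (dist_toShiftClass_le (extend_mem_ellZero _ _ _) hx
    (half_pos hε).le fun j => ?_).trans_lt (half_lt_self hε)⟩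
  by_cases h : j ∈ Set.Icc (-n : ℤ) n
  · rw [extend_apply_of_mem _ h, window, dist_self]
    exact (half_pos hε).le
  · rw [extend_apply_of_notMem _ h, dist_zero_left]
    by_contra! hc
    have := hM ⟨j, not_lt.2 hc.le, rfl⟩
    exact h ⟨by omega, by omega⟩

theorem measurable_window {E : Type*} [MeasurableSpace E] (s t : ℤ) :
    Measurable (window (E := E) s t) :=
  measurable_pi_lambda _ fun _ => measurable_pi_apply _

variable [MeasurableSpace E]

theorem measurableSet_ellZero [OpensMeasurableSpace E] : MeasurableSet (ellZero E) := by
  have : (cofinite : Filter ℤ).IsCountablyGenerated := by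
    rw [Int.cofinite_eq]
    infer_instance
  exact measurableSet_tendsto (l := cofinite) (𝓝 (0 : ℝ))
    (f := fun (j : ℤ) (x : ℤ → E) => ‖x j‖) fun j => (measurable_pi_apply j).norm

theorem measurable_seqMax [OpensMeasurableSpace E] : Measurable (seqMax : (ℤ → E) → ℝ) :=
  Measurable.iSup fun j => (measurable_pi_apply j).norm

theorem measurable_block (m : ℕ) : Measurable (block m : (ℤ → E) → ℤ → E) := by
  refine measurable_pi_lambda _ fun j => ?_
  unfold block
  split_ifs
  · exact measurable_pi_apply j
  · exact measurable_const

theorem measurable_toShiftClass [BorelSpace E] [SecondCountableTopology E] :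
    Measurable (toShiftClass : (ℤ → E) → ShiftClass E) := by
  classical
  have hT : ∀ n : ℕ, Measurable fun x : ℤ → E =>
      if x ∈ ellZero E then toShiftClass (extend (-n : ℤ) n (window (-n : ℤ) n x))
      else ShiftClass.mk 0 := fun n =>
    Measurable.ite measurableSet_ellZero
      ((continuous_toShiftClass_extend _ _).measurable.comp (measurable_window _ _))
      measurable_const
  refine measurable_of_tendsto_metrizable hT (tendsto_pi_nhds.2 fun x => ?_)
  by_cases hx : x ∈ ellZero E
  · simp only [if_pos hx]
    exact tendsto_toShiftClass_truncate hx
  · simp only [if_neg hx]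
    rw [toShiftClass, dif_neg hx]
    exact tendsto_const_nhds

end Sequences

/-! ### Convergence of boundedly finite measures in polar coordinates -/

theorem tendsto_of_forall_approx {x : ℕ → ℝ} {L : ℝ}
    (h : ∀ ε > 0, ∃ a e : ℕ → ℝ, ∃ a' e' : ℝ, Tendsto a atTop (𝓝 a') ∧ Tendsto e atTop (𝓝 e') ∧
      e' < ε ∧ (∀ n, |x n - a n| ≤ e n) ∧ |L - a'| ≤ e') : Tendsto x atTop (𝓝 L) := by
  rw [Metric.tendsto_nhds]
  intro ε hε
  obtain ⟨a, e, a', e', ha, he, hlt, hx, hL⟩ := h (ε / 3) (by positivity)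
  filter_upwards [Metric.tendsto_nhds.1 ha (ε / 3) (by positivity),
    he.eventually (gt_mem_nhds hlt)] with n h1 h2
  rw [Real.dist_eq] at h1 ⊢
  have h3 := hx n
  rw [abs_le] at h3 hL
  rw [abs_lt] at h1 ⊢
  constructor <;> linarith

/-- Continuous non-negative functions on a metric space are limits of increasing sequences of
Lipschitz functions. -/
theorem exists_lipschitz_approx {S : Type*} [PseudoMetricSpace S] {f : S → ℝ} (hf : Continuous f)
    (h0 : ∀ x, 0 ≤ f x) : ∃ F : ℕ → S → ℝ, (∀ k : ℕ, LipschitzWith k (F k)) ∧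
      (∀ k x, 0 ≤ F k x) ∧ (∀ k x, F k x ≤ f x) ∧
      ∀ x, Tendsto (fun k => F k x) atTop (𝓝 (f x)) := by
  have hbdd : ∀ (k : ℕ) (x : S), BddBelow (Set.range fun y => f y + k * dist x y) := fun k x =>
    ⟨0, by rintro _ ⟨y, rfl⟩; have := h0 y; positivity⟩
  have hnonneg : ∀ (k : ℕ) x, 0 ≤ ⨅ y, f y + k * dist x y := fun k x =>
    Real.iInf_nonneg fun y => by have := h0 y; positivity
  have hle : ∀ (k : ℕ) x, ⨅ y, f y + k * dist x y ≤ f x := fun k x =>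
    (ciInf_le (hbdd k x) x).trans (by simp)
  refine ⟨fun k x => ⨅ y, f y + k * dist x y, fun k => ?_, hnonneg, hle, fun x => ?_⟩
  · refine LipschitzWith.of_le_add_mul _ fun x y => ?_
    have : Nonempty S := ⟨x⟩
    rw [← sub_le_iff_le_add]
    refine le_ciInf fun z => ?_
    rw [sub_le_iff_le_add]
    refine (ciInf_le (hbdd k x) z).trans ?_
    have := mul_le_mul_of_nonneg_left (dist_triangle x y z) (Nat.cast_nonneg (α := ℝ) k)
    simp only [NNReal.coe_natCast]
    linarith
  · rw [Metric.tendsto_atTop]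
    intro ε hε
    obtain ⟨δ, hδ, hball⟩ := Metric.continuous_iff.1 hf x (ε / 2) (by positivity)
    obtain ⟨K, hK⟩ := exists_nat_gt (f x / δ)
    refine ⟨K, fun k hk => ?_⟩
    have : Nonempty S := ⟨x⟩
    have h1 : f x - ε / 2 ≤ ⨅ y, f y + k * dist x y := by
      refine le_ciInf fun y => ?_
      rcases lt_or_ge (dist y x) δ with hy | hy
      · have h2 := hball y hy
        rw [Real.dist_eq, abs_lt] at h2
        have : 0 ≤ (k : ℝ) * dist x y := by positivity
        linarith
      · rw [div_lt_iff₀ hδ] at hK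
        have h3 : (K : ℝ) * δ ≤ k * dist x y := by
          rw [dist_comm x y]
          gcongr
        have := h0 y
        linarith
    rw [Real.dist_eq, abs_lt]
    have := hle k x
    constructor <;> linarith

section MZero

variable {E : Type*} [NormedAddCommGroup E]

theorem ShiftClass.indicator_of_lt {u : ℝ} {x : ShiftClass E} (h : u < x.maxNorm)
    (f : ShiftClass E → ℝ) : {x : ShiftClass E | u < x.maxNorm}.indicator f x = f x :=
  Set.indicator_of_mem (s := {x : ShiftClass E | u < x.maxNorm}) h f

theorem ShiftClass.indicator_of_le {u : ℝ} {x : ShiftClass E} (h : x.maxNorm ≤ u)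
    (f : ShiftClass E → ℝ) : {x : ShiftClass E | u < x.maxNorm}.indicator f x = 0 :=
  Set.indicator_of_notMem (s := {x : ShiftClass E | u < x.maxNorm}) (not_lt.2 h) f

theorem ShiftClass.lt_of_indicator_ne_zero {u : ℝ} {x : ShiftClass E} {f : ShiftClass E → ℝ}
    (h : {x : ShiftClass E | u < x.maxNorm}.indicator f x ≠ 0) : u < x.maxNorm :=
  Set.mem_of_indicator_ne_zero (s := {x : ShiftClass E | u < x.maxNorm}) h

theorem ShiftClass.abs_indicator_le (u : ℝ) (x : ShiftClass E) {f : ShiftClass E → ℝ} {B : ℝ}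
    (h : ∀ x, |f x| ≤ B) : |{x : ShiftClass E | u < x.maxNorm}.indicator f x| ≤ B := by
  rcases lt_or_ge u x.maxNorm with hx | hx
  · rw [indicator_of_lt hx]
    exact h x
  · rw [indicator_of_le hx, abs_zero]
    exact (abs_nonneg _).trans (h x)

theorem BoundedlyFinite.lt_top {μ : Measure (ShiftClass E)} (hμ : BoundedlyFinite μ) {u : ℝ}
    (hu : 0 < u) : μ {x | u < x.maxNorm} < ∞ :=
  hμ _ (ShiftClass.measurableSet_lt_maxNorm u) ⟨u, hu, fun _ hx => hx⟩

theorem BoundedlyFinite.integrable {μ : Measure (ShiftClass E)} (hμ : BoundedlyFinite μ)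
    {f : ShiftClass E → ℝ} (hf : Measurable f) {B ε : ℝ} (hB : ∀ x, |f x| ≤ B) (hε : 0 < ε)
    (hsupp : ∀ x, f x ≠ 0 → ε < x.maxNorm) : Integrable f μ := by
  have h : IntegrableOn f {x | ε < x.maxNorm} μ :=
    Measure.integrableOn_of_bounded (hμ.lt_top hε).ne hf.aestronglyMeasurable
      (Eventually.of_forall hB)
  exact (integrableOn_iff_integrable_of_support_subset hsupp).1 h

theorem BoundedlyFinite.integral_indicator_const {μ : Measure (ShiftClass E)}
    (hμ : BoundedlyFinite μ) {u : ℝ} (hu : 0 < u) {C : ℝ} :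
    Integrable ({x : ShiftClass E | u < x.maxNorm}.indicator fun _ => C) μ ∧
    ∫ x, {x : ShiftClass E | u < x.maxNorm}.indicator (fun _ => C) x ∂μ =
      C * μ.real {x | u < x.maxNorm} := by
  have hm := ShiftClass.measurableSet_lt_maxNorm (E := E) u
  constructor
  · rw [integrable_indicator_iff hm]
    exact integrableOn_const (hμ.lt_top hu).ne
  · rw [integral_indicator hm, setIntegral_const, smul_eq_mul, mul_comm]

theorem TendstoMZero.tendsto_integral {μs : ℕ → Measure (ShiftClass E)}
    {μ : Measure (ShiftClass E)} (h : TendstoMZero μs μ) {f : ShiftClass E → ℝ}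
    (hf : Continuous f) {B ε : ℝ} (hB : ∀ x, |f x| ≤ B) (hε : 0 < ε)
    (hsupp : ∀ x, f x ≠ 0 → ε < x.maxNorm) :
    Tendsto (fun n => ∫ x, f x ∂(μs n)) atTop (𝓝 (∫ x, f x ∂μ)) :=
  h.2.2 (BoundedContinuousFunction.ofNormedAddCommGroup f hf B hB) ⟨ε, hε, hsupp⟩

theorem TendstoMZero.tendsto_setIntegral {μs : ℕ → Measure (ShiftClass E)}
    {μ : Measure (ShiftClass E)} (h : TendstoMZero μs μ) {u : ℝ} (hu : 0 < u)
    (hcont : ContinuousAt (fun v => μ.real {x | v < x.maxNorm}) u)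
    (G : ShiftClass E →ᵇ ℝ) :
    Tendsto (fun n => ∫ x in {x | u < x.maxNorm}, G x ∂(μs n)) atTop
      (𝓝 (∫ x in {x | u < x.maxNorm}, G x ∂μ)) := by
  refine tendsto_of_forall_approx fun ε hε => ?_
  have hC : 0 < ‖G‖ + 1 := by positivity
  obtain ⟨η, hη, hT⟩ := Metric.continuousAt_iff.1 hcont (ε / (2 * (‖G‖ + 1))) (by positivity)
  obtain ⟨δ, hδ, hδη, hδu⟩ : ∃ δ > 0, 3 * δ < η ∧ 3 * δ < u :=
    ⟨min η u / 4, by positivity, by linarith [min_le_left η u], by linarith [min_le_right η u]⟩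
  set b : ShiftClass E → ℝ := fun x => max 0 (min 1 (2 - |x.maxNorm - u| / δ)) with hb
  set k : ShiftClass E → ℝ := fun x => max 0 (min 1 (1 + (x.maxNorm - u) / δ)) with hk
  have hρ := ShiftClass.continuous_maxNorm (E := E)
  have hbc : Continuous b := by fun_prop
  have hkc : Continuous k := by fun_prop
  have hb0 : ∀ x, 0 ≤ b x := fun x => le_max_left _ _
  have hk0 : ∀ x, 0 ≤ k x := fun x => le_max_left _ _
  have hb1 : ∀ x, b x ≤ 1 := fun x => max_le zero_le_one (min_le_left _ _)
  have hk1 : ∀ x, k x ≤ 1 := fun x => max_le zero_le_one (min_le_left _ _)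
  have hbs : ∀ x, b x ≠ 0 → |x.maxNorm - u| < 2 * δ := fun x hx => by
    by_contra! hc
    refine hx (max_eq_left ((min_le_right _ _).trans ?_))
    rw [sub_nonpos, le_div_iff₀ hδ]
    exact hc
  have hks : ∀ x, k x ≠ 0 → u - 2 * δ < x.maxNorm := fun x hx => by
    by_contra! hc
    refine hx (max_eq_left ((min_le_right _ _).trans ?_))
    have : (x.maxNorm - u) / δ ≤ -1 := by rw [div_le_iff₀ hδ]; linarith
    linarith
  have hkb : ∀ x : ShiftClass E,
      |{x : ShiftClass E | u < x.maxNorm}.indicator 1 x - k x| ≤ b x := by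
    intro x
    rcases lt_or_ge u x.maxNorm with hx | hx
    · have h1 : k x = 1 := by
        have : 0 ≤ (x.maxNorm - u) / δ := div_nonneg (by linarith) hδ.le
        simp only [hk]
        rw [min_eq_left (by linarith), max_eq_right zero_le_one]
      rw [ShiftClass.indicator_of_lt hx, h1]
      simpa using hb0 x
    · rw [ShiftClass.indicator_of_le hx, zero_sub, abs_neg, abs_of_nonneg (hk0 x)]
      by_cases hx' : u - δ ≤ x.maxNorm
      · have h1 : b x = 1 := by
          have : |x.maxNorm - u| / δ ≤ 1 := by
            rw [div_le_one hδ, abs_le]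
            constructor <;> linarith
          simp only [hb]
          rw [min_eq_left (by linarith), max_eq_right zero_le_one]
        rw [h1]
        exact hk1 x
      · have h1 : k x = 0 := by
          refine max_eq_left ((min_le_right _ _).trans ?_)
          have : (x.maxNorm - u) / δ ≤ -1 := by rw [div_le_iff₀ hδ]; linarith
          linarith
        rw [h1]
        exact hb0 x
  have hG : ∀ x, |G x| ≤ ‖G‖ := fun x => G.norm_coe_le_norm x
  have hkG : ∀ x, |k x * G x| ≤ ‖G‖ := fun x => by
    rw [abs_mul, abs_of_nonneg (hk0 x)]
    exact (mul_le_mul (hk1 x) (hG x) (abs_nonneg _) zero_le_one).trans (one_mul _).le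
  have hpos : 0 < u - 3 * δ := by linarith
  have hkGs : ∀ x, k x * G x ≠ 0 → u - 3 * δ < x.maxNorm := fun x hx => by
    have := hks x (left_ne_zero_of_mul hx)
    linarith
  have hbs' : ∀ x, b x ≠ 0 → u - 3 * δ < x.maxNorm := fun x hx => by
    have := (abs_lt.1 (hbs x hx)).1
    linarith
  have hb1' : ∀ x, |b x| ≤ 1 := fun x => by rw [abs_of_nonneg (hb0 x)]; exact hb1 x
  have key : ∀ m : Measure (ShiftClass E), BoundedlyFinite m →
      |∫ x in {x | u < x.maxNorm}, G x ∂m - ∫ x, k x * G x ∂m| ≤ ‖G‖ * ∫ x, b x ∂m := by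
    intro m hm
    have hms := ShiftClass.measurableSet_lt_maxNorm (E := E) u
    have h1 : Integrable ({x : ShiftClass E | u < x.maxNorm}.indicator G) m := by
      refine hm.integrable (G.continuous.measurable.indicator hms) (B := ‖G‖)
        (fun x => ShiftClass.abs_indicator_le u x hG) hu
        fun x hx => ShiftClass.lt_of_indicator_ne_zero hx
    have h2 : Integrable (fun x => k x * G x) m :=
      hm.integrable (hkc.mul G.continuous).measurable hkG hpos hkGs
    have h3 : Integrable b m := hm.integrable hbc.measurable hb1' hpos hbs'
    rw [← integral_indicator hms, ← integral_sub h1 h2, ← integral_const_mul]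
    refine norm_integral_le_of_norm_le
      (f := fun x => {x : ShiftClass E | u < x.maxNorm}.indicator G x - k x * G x)
      (h3.const_mul ‖G‖) (Eventually.of_forall fun x => ?_)
    have h4 : {x : ShiftClass E | u < x.maxNorm}.indicator G x - k x * G x =
        ({x : ShiftClass E | u < x.maxNorm}.indicator 1 x - k x) * G x := by
      rw [sub_mul]
      congr 1
      rcases lt_or_ge u x.maxNorm with hx | hx
      · rw [ShiftClass.indicator_of_lt hx, ShiftClass.indicator_of_lt hx, Pi.one_apply, one_mul]
      · rw [ShiftClass.indicator_of_le hx, ShiftClass.indicator_of_le hx, zero_mul]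
    rw [h4, norm_mul, mul_comm]
    exact mul_le_mul (hG x) (hkb x) (abs_nonneg _) (norm_nonneg _)
  refine ⟨_, _, _, _, h.tendsto_integral (hkc.mul G.continuous) hkG hpos hkGs,
    (h.tendsto_integral hbc hb1' hpos hbs').const_mul ‖G‖, ?_, fun n => key _ (h.1 n),
    key _ h.2.1⟩
  have hint : ∫ x, b x ∂μ ≤
      μ.real {x | u - 3 * δ < x.maxNorm} - μ.real {x | u + 3 * δ < x.maxNorm} := by
    obtain ⟨i1, e1⟩ := h.2.1.integral_indicator_const hpos (C := 1)
    obtain ⟨i2, e2⟩ := h.2.1.integral_indicator_const (by linarith : 0 < u + 3 * δ) (C := 1)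
    rw [one_mul] at e1 e2
    rw [← e1, ← e2, ← integral_sub i1 i2]
    refine integral_mono (h.2.1.integrable hbc.measurable hb1' hpos hbs') (i1.sub i2) fun x => ?_
    by_cases hx : b x = 0
    · rw [hx, sub_nonneg]
      refine Set.indicator_le_indicator_of_subset (fun y hy => ?_) (fun _ => zero_le_one) x
      rw [Set.mem_ofPred_eq] at hy ⊢
      linarith
    · have := abs_lt.1 (hbs x hx)
      rw [ShiftClass.indicator_of_lt (by linarith), ShiftClass.indicator_of_le (by linarith),
        sub_zero]
      exact hb1 x
  have t1 := hT (x := u - 3 * δ) (by rw [Real.dist_eq, abs_lt]; constructor <;> linarith)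
  have t2 := hT (x := u + 3 * δ) (by rw [Real.dist_eq, abs_lt]; constructor <;> linarith)
  rw [Real.dist_eq, abs_lt] at t1 t2
  have hlt : ∫ x, b x ∂μ < 2 * (ε / (2 * (‖G‖ + 1))) := by linarith
  have h0 : 0 ≤ ∫ x, b x ∂μ := integral_nonneg hb0
  calc ‖G‖ * ∫ x, b x ∂μ ≤ (‖G‖ + 1) * ∫ x, b x ∂μ := by nlinarith
    _ < (‖G‖ + 1) * (2 * (ε / (2 * (‖G‖ + 1)))) := by gcongr
    _ = ε := by field_simp

theorem eventually_lt_integral_of_nonneg {μs : ℕ → Measure (ShiftClass E)}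
    {μ : Measure (ShiftClass E)} (hfin : ∀ n, BoundedlyFinite (μs n))
    (hfin' : BoundedlyFinite μ)
    (hlip : ∀ (f : ShiftClass E → ℝ) (L : NNReal), LipschitzWith L f → ∀ B ε : ℝ,
      (∀ x, |f x| ≤ B) → 0 < ε → (∀ x, f x ≠ 0 → ε < x.maxNorm) →
      Tendsto (fun n => ∫ x, f x ∂(μs n)) atTop (𝓝 (∫ x, f x ∂μ)))
    {f : ShiftClass E → ℝ} (hf : Continuous f) (h0 : ∀ x, 0 ≤ f x) {B ε : ℝ}
    (hB : ∀ x, |f x| ≤ B) (hε : 0 < ε) (hsupp : ∀ x, f x ≠ 0 → ε < x.maxNorm)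
    {a : ℝ} (ha : a < ∫ x, f x ∂μ) : ∀ᶠ n in atTop, a < ∫ x, f x ∂(μs n) := by
  obtain ⟨F, hF, hF0, hFf, hlim⟩ := exists_lipschitz_approx hf h0
  have hFB : ∀ k x, |F k x| ≤ B := fun k x => by
    rw [abs_of_nonneg (hF0 k x)]
    exact (hFf k x).trans ((le_abs_self _).trans (hB x))
  have hFs : ∀ k x, F k x ≠ 0 → ε < x.maxNorm := fun k x hx =>
    hsupp x (((hF0 k x).lt_of_ne' hx).trans_le (hFf k x)).ne'
  have hint : ∀ m, BoundedlyFinite m → Integrable f m := fun m hm =>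
    hm.integrable hf.measurable hB hε hsupp
  have hint' : ∀ k m, BoundedlyFinite m → Integrable (F k) m := fun k m hm =>
    hm.integrable (hF k).continuous.measurable (hFB k) hε (hFs k)
  have hdom : Tendsto (fun k => ∫ x, F k x ∂μ) atTop (𝓝 (∫ x, f x ∂μ)) :=
    tendsto_integral_of_dominated_convergence f
      (fun k => (hF k).continuous.measurable.aestronglyMeasurable) (hint μ hfin')
      (fun k => Eventually.of_forall fun x => by
        rw [Real.norm_eq_abs, abs_of_nonneg (hF0 k x)]
        exact hFf k x)
      (Eventually.of_forall hlim)
  obtain ⟨k, hk⟩ := (hdom.eventually (lt_mem_nhds ha)).exists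
  filter_upwards [(hlip (F k) k (hF k) B ε (hFB k) hε (hFs k)).eventually (lt_mem_nhds hk)]
    with n hn
  exact hn.trans_le (integral_mono (hint' k _ (hfin n)) (hint _ (hfin n)) (hFf k))

variable [NormedSpace ℝ E]

/-- A function of a class `x`, approximated by its values at finitely many radii. -/
noncomputable def radialStep (f : ShiftClass E → ℝ) (ε δ : ℝ) (K : ℕ) (x : ShiftClass E) : ℝ :=
  ∑ i ∈ Finset.range K,
    ({x : ShiftClass E | ε + i * δ < x.maxNorm}.indicator
        (fun x => f ((ε + i * δ) • ShiftClass.normalize ε x)) x -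
      {x : ShiftClass E | ε + (i + 1 : ℕ) * δ < x.maxNorm}.indicator
        (fun x => f ((ε + i * δ) • ShiftClass.normalize ε x)) x)

theorem radialStep_spec {f : ShiftClass E → ℝ} {L : NNReal} (hf : LipschitzWith L f) {ε δ : ℝ}
    (hε : 0 < ε) (hδ : 0 < δ) (K : ℕ) {x : ShiftClass E} (hx : ε < x.maxNorm) :
    (ε + K * δ < x.maxNorm → radialStep f ε δ K x = 0) ∧
      (x.maxNorm ≤ ε + K * δ → |f x - radialStep f ε δ K x| ≤ L * δ) := by
  induction K with
  | zero => exact ⟨fun _ => by simp [radialStep], fun h => by simp at h; linarith⟩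
  | succ K ih =>
    have hstep : ε + (K : ℝ) * δ < ε + (K + 1 : ℕ) * δ := by push_cast; linarith
    rw [radialStep, Finset.sum_range_succ, ← radialStep]
    refine ⟨fun h => ?_, fun h => ?_⟩
    · rw [ih.1 (hstep.trans h), ShiftClass.indicator_of_lt h,
        ShiftClass.indicator_of_lt (hstep.trans h)]
      ring
    · rw [ShiftClass.indicator_of_le h, sub_zero]
      rcases lt_or_ge (ε + K * δ) x.maxNorm with hK | hK
      · rw [ih.1 hK, zero_add, ShiftClass.indicator_of_lt hK, ← Real.dist_eq]
        have hpos : 0 < x.maxNorm := hε.trans hx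
        set y := ShiftClass.normalize ε x with hy
        rw [ShiftClass.normalize_of_le hx.le] at hy
        have hxy : x = x.maxNorm • y := by
          rw [hy, ShiftClass.smul_smul', mul_inv_cancel₀ hpos.ne', ShiftClass.one_smul']
        have hy1 : y.maxNorm = 1 := by
          rw [hy, ShiftClass.maxNorm_smul, abs_of_pos (inv_pos.2 hpos), inv_mul_cancel₀ hpos.ne']
        refine (hf.dist_le_mul _ _).trans ?_
        gcongr
        have := ShiftClass.dist_smul_left_le x.maxNorm (ε + K * δ) y
        rw [← hxy, hy1, mul_one] at this
        refine this.trans (abs_le.2 ⟨by linarith, ?_⟩)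
        push_cast at h
        linarith
      · rw [ShiftClass.indicator_of_le hK, add_zero]
        exact ih.2 hK

theorem abs_sub_radialStep_le {f : ShiftClass E → ℝ} {L : NNReal} (hf : LipschitzWith L f)
    {B ε δ : ℝ} (hB : ∀ x, |f x| ≤ B) (hε : 0 < ε) (hδ : 0 < δ)
    (hsupp : ∀ x, f x ≠ 0 → ε < x.maxNorm) (K : ℕ) (x : ShiftClass E) :
    |f x - radialStep f ε δ K x| ≤
      {x : ShiftClass E | ε < x.maxNorm}.indicator (fun _ => L * δ) x +
        {x : ShiftClass E | ε + K * δ < x.maxNorm}.indicator (fun _ => B) x := by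
  have hB0 : 0 ≤ B := (abs_nonneg _).trans (hB x)
  have hLδ : 0 ≤ (L : ℝ) * δ := by positivity
  rcases lt_or_ge ε x.maxNorm with hx | hx
  · rw [ShiftClass.indicator_of_lt hx]
    rcases lt_or_ge (ε + K * δ) x.maxNorm with hK | hK
    · rw [ShiftClass.indicator_of_lt hK, (radialStep_spec hf hε hδ K hx).1 hK, sub_zero]
      linarith [hB x]
    · rw [ShiftClass.indicator_of_le hK, add_zero]
      exact (radialStep_spec hf hε hδ K hx).2 hK
  · have h1 : f x = 0 := by
      by_contra h
      exact absurd (hsupp x h) (not_lt.2 hx)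
    have h2 : radialStep f ε δ K x = 0 := by
      refine Finset.sum_eq_zero fun i _ => ?_
      have : 0 ≤ (i : ℝ) * δ := by positivity
      have h' : 0 ≤ ((i + 1 : ℕ) : ℝ) * δ := by positivity
      rw [ShiftClass.indicator_of_le (by linarith), ShiftClass.indicator_of_le (by linarith),
        sub_zero]
    rw [h1, h2, sub_zero, abs_zero]
    exact add_nonneg (Set.indicator_nonneg (fun _ _ => hLδ) _)
      (Set.indicator_nonneg (fun _ _ => hB0) _)

section Converse

variable {μs : ℕ → Measure (ShiftClass E)} {μ : Measure (ShiftClass E)}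

theorem tendsto_integral_of_lipschitz (hfin : ∀ n, BoundedlyFinite (μs n))
    (hfin' : BoundedlyFinite μ)
    (htail : Tendsto (fun u => μ.real {x | u < x.maxNorm}) atTop (𝓝 0))
    (hconv : ∀ u > 0, ∀ F : ShiftClass E →ᵇ ℝ,
      Tendsto (fun n => ∫ x in {x | u < x.maxNorm}, F (ShiftClass.normalize u x) ∂(μs n)) atTop
        (𝓝 (∫ x in {x | u < x.maxNorm}, F (ShiftClass.normalize u x) ∂μ)))
    {f : ShiftClass E → ℝ} {L : NNReal} (hf : LipschitzWith L f) {B ε : ℝ}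
    (hB : ∀ x, |f x| ≤ B) (hε : 0 < ε) (hsupp : ∀ x, f x ≠ 0 → ε < x.maxNorm) :
    Tendsto (fun n => ∫ x, f x ∂(μs n)) atTop (𝓝 (∫ x, f x ∂μ)) := by
  have hB0 : 0 ≤ B := (abs_nonneg _).trans (hB (ShiftClass.mk 0))
  have hreal : ∀ u > 0, Tendsto (fun n => (μs n).real {x | u < x.maxNorm}) atTop
      (𝓝 (μ.real {x | u < x.maxNorm})) := fun u hu => by
    simpa using hconv u hu (BoundedContinuousFunction.const _ 1)
  refine tendsto_of_forall_approx fun η hη => ?_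
  set T := μ.real {x | ε < x.maxNorm} with hTdef
  have hT : 0 ≤ T := measureReal_nonneg
  obtain ⟨δ, hδ, hδη⟩ : ∃ δ > 0, L * δ * T < η / 2 := by
    refine ⟨η / (2 * (L * T + 1)), by positivity, ?_⟩
    have h1 : (0 : ℝ) < L * T + 1 := by positivity
    have h2 : L * (η / (2 * (L * T + 1))) * T = (L * T) / (L * T + 1) * (η / 2) := by
      field_simp
    rw [h2]
    have h3 : (L * T) / (L * T + 1) < (1 : ℝ) := by rw [div_lt_one h1]; linarith
    nlinarith
  obtain ⟨M, hM⟩ : ∃ M, ∀ u ≥ M, B * μ.real {x | u < x.maxNorm} < η / 2 := by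
    have := htail.const_mul B
    rw [mul_zero] at this
    exact eventually_atTop.1 (this.eventually (gt_mem_nhds (half_pos hη)))
  obtain ⟨K, hK⟩ := exists_nat_gt (M / δ)
  rw [div_lt_iff₀ hδ] at hK
  have hu : ∀ i : ℕ, ε ≤ ε + i * δ := fun i => by
    have : 0 ≤ (i : ℝ) * δ := by positivity
    linarith
  have hu0 : ∀ i : ℕ, 0 < ε + i * δ := fun i => hε.trans_le (hu i)
  have hcn := ShiftClass.continuous_normalize (E := E) hε
  have hFc : ∀ i : ℕ, Continuous fun x => f ((ε + i * δ) • x) := fun i =>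
    hf.continuous.comp (continuous_const_smul _)
  -- the steps are integrable and their integrals converge
  have hint : ∀ m : Measure (ShiftClass E), BoundedlyFinite m → ∀ i j : ℕ,
      Integrable ({x : ShiftClass E | ε + j * δ < x.maxNorm}.indicator
        (fun x => f ((ε + i * δ) • ShiftClass.normalize ε x))) m := fun m hm i j => by
    exact hm.integrable (((hFc i).comp hcn).measurable.indicator
      (ShiftClass.measurableSet_lt_maxNorm _)) (B := B)
      (fun x => ShiftClass.abs_indicator_le _ x fun _ => hB _) (hu0 j)
      fun x hx => ShiftClass.lt_of_indicator_ne_zero hx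
  have hterm : ∀ i j : ℕ, Tendsto (fun n =>
      ∫ x, {x : ShiftClass E | ε + j * δ < x.maxNorm}.indicator
        (fun x => f ((ε + i * δ) • ShiftClass.normalize ε x)) x ∂(μs n)) atTop
      (𝓝 (∫ x, {x : ShiftClass E | ε + j * δ < x.maxNorm}.indicator
        (fun x => f ((ε + i * δ) • ShiftClass.normalize ε x)) x ∂μ)) := fun i j => by
    have hms := ShiftClass.measurableSet_lt_maxNorm (E := E) (ε + j * δ)
    have hcongr : ∀ m : Measure (ShiftClass E),
        ∫ x, {x : ShiftClass E | ε + j * δ < x.maxNorm}.indicator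
          (fun x => f ((ε + i * δ) • ShiftClass.normalize ε x)) x ∂m =
        ∫ x in {x | ε + j * δ < x.maxNorm},
          f ((ε + i * δ) • ShiftClass.normalize (ε + j * δ) x) ∂m := fun m => by
      rw [integral_indicator hms]
      refine setIntegral_congr_fun hms fun x hx => ?_
      rw [Set.mem_ofPred_eq] at hx
      rw [ShiftClass.normalize_of_le hx.le, ShiftClass.normalize_of_le ((hu j).trans hx.le)]
    simp only [hcongr]
    exact hconv _ (hu0 j) (BoundedContinuousFunction.ofNormedAddCommGroup _ (hFc i) B
      fun x => hB _)
  have hstep : Tendsto (fun n => ∫ x, radialStep f ε δ K x ∂(μs n)) atTop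
      (𝓝 (∫ x, radialStep f ε δ K x ∂μ)) := by
    have hsum : ∀ m : Measure (ShiftClass E), BoundedlyFinite m →
        ∫ x, radialStep f ε δ K x ∂m = ∑ i ∈ Finset.range K,
          (∫ x, {x : ShiftClass E | ε + i * δ < x.maxNorm}.indicator
              (fun x => f ((ε + i * δ) • ShiftClass.normalize ε x)) x ∂m -
            ∫ x, {x : ShiftClass E | ε + (i + 1 : ℕ) * δ < x.maxNorm}.indicator
              (fun x => f ((ε + i * δ) • ShiftClass.normalize ε x)) x ∂m) := fun m hm => by
      simp only [radialStep]
      rw [integral_finsetSum _ fun i _ => ?_]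
      swap
      · exact (hint m hm i i).sub (hint m hm i (i + 1))
      exact Finset.sum_congr rfl fun i _ => integral_sub (hint m hm i i) (hint m hm i (i + 1))
    rw [hsum μ hfin']
    simp only [hsum _ (hfin _)]
    exact tendsto_finsetSum _ fun i _ => (hterm i i).sub (hterm i (i + 1))
  have key : ∀ m : Measure (ShiftClass E), BoundedlyFinite m →
      |∫ x, f x ∂m - ∫ x, radialStep f ε δ K x ∂m| ≤
        L * δ * m.real {x | ε < x.maxNorm} + B * m.real {x | ε + K * δ < x.maxNorm} := by
    intro m hm
    obtain ⟨i1, e1⟩ := hm.integral_indicator_const hε (C := L * δ)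
    obtain ⟨i2, e2⟩ := hm.integral_indicator_const (hu0 K) (C := B)
    have h1 : Integrable f m := hm.integrable hf.continuous.measurable hB hε hsupp
    have h2 : Integrable (radialStep f ε δ K) m :=
      integrable_finsetSum _ fun i _ => (hint m hm i i).sub (hint m hm i (i + 1))
    rw [← e1, ← e2, ← integral_add i1 i2, ← integral_sub h1 h2]
    exact norm_integral_le_of_norm_le (f := fun x => f x - radialStep f ε δ K x) (i1.add i2)
      (Eventually.of_forall fun x => abs_sub_radialStep_le hf hB hε hδ hsupp K x)
  refine ⟨_, _, _, _, hstep, ((hreal ε hε).const_mul _).add ((hreal _ (hu0 K)).const_mul _), ?_,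
    fun n => key _ (hfin n), key _ hfin'⟩
  have := hM (ε + K * δ) (by linarith)
  linarith

theorem tendstoMZero_of_tendsto_setIntegral (hfin : ∀ n, BoundedlyFinite (μs n))
    (hfin' : BoundedlyFinite μ)
    (htail : Tendsto (fun u => μ.real {x | u < x.maxNorm}) atTop (𝓝 0))
    (hconv : ∀ u > 0, ∀ F : ShiftClass E →ᵇ ℝ,
      Tendsto (fun n => ∫ x in {x | u < x.maxNorm}, F (ShiftClass.normalize u x) ∂(μs n)) atTop
        (𝓝 (∫ x in {x | u < x.maxNorm}, F (ShiftClass.normalize u x) ∂μ))) :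
    TendstoMZero μs μ := by
  refine ⟨hfin, hfin', fun f => ?_⟩
  rintro ⟨ε, hε, hsupp⟩
  have hlip : ∀ (f : ShiftClass E → ℝ) (L : NNReal), LipschitzWith L f → ∀ B ε : ℝ,
      (∀ x, |f x| ≤ B) → 0 < ε → (∀ x, f x ≠ 0 → ε < x.maxNorm) →
      Tendsto (fun n => ∫ x, f x ∂(μs n)) atTop (𝓝 (∫ x, f x ∂μ)) :=
    fun f L hf B ε hB hε hs =>
      tendsto_integral_of_lipschitz hfin hfin' htail hconv hf hB hε hs
  have hfB : ∀ x, |f x| ≤ ‖f‖ := fun x => f.norm_coe_le_norm x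
  have hε2 : 0 < ε / 2 := half_pos hε
  -- a Lipschitz function between the indicators of two balls
  set h : ShiftClass E → ℝ := fun x => max 0 (min 1 ((ε / 2)⁻¹ * (x.maxNorm - ε / 2))) with hh
  have hhL : LipschitzWith (Real.toNNReal (ε / 2)⁻¹) h := by
    refine LipschitzWith.const_max (LipschitzWith.const_min ?_ _) _
    refine LipschitzWith.of_dist_le_mul fun x y => ?_
    rw [Real.dist_eq, ← mul_sub, abs_mul, abs_of_pos (inv_pos.2 hε2),
      Real.coe_toNNReal _ (inv_pos.2 hε2).le, sub_sub_sub_cancel_right]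
    gcongr
    exact ShiftClass.abs_maxNorm_sub_le x y
  have hh0 : ∀ x, 0 ≤ h x := fun x => le_max_left _ _
  have hh1 : ∀ x, |h x| ≤ 1 := fun x => by
    rw [abs_of_nonneg (hh0 x)]
    exact max_le zero_le_one (min_le_left _ _)
  have hhs : ∀ x, h x ≠ 0 → ε / 2 < x.maxNorm := fun x hx => by
    by_contra! hc
    refine hx (max_eq_left ((min_le_right _ _).trans ?_))
    exact mul_nonpos_of_nonneg_of_nonpos (inv_pos.2 hε2).le (by linarith)
  have hhf : ∀ x, |f x| ≤ ‖f‖ * h x := fun x => by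
    by_cases hx : f x = 0
    · rw [hx, abs_zero]
      exact mul_nonneg (norm_nonneg _) (hh0 x)
    · have : h x = 1 := by
        have h1 : 1 ≤ (ε / 2)⁻¹ * (x.maxNorm - ε / 2) := by
          rw [← inv_mul_cancel₀ hε2.ne']
          gcongr
          linarith [hsupp x hx]
        simp only [hh]
        rw [min_eq_left h1, max_eq_right zero_le_one]
      rw [this, mul_one]
      exact hfB x
  have hhconv := hlip h _ hhL 1 (ε / 2) hh1 hε2 hhs
  have hhint : ∀ m, BoundedlyFinite m → Integrable h m := fun m hm =>
    hm.integrable hhL.continuous.measurable hh1 hε2 hhs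
  have hfint : ∀ m, BoundedlyFinite m → Integrable f m := fun m hm =>
    hm.integrable f.continuous.measurable hfB hε hsupp
  have lower : ∀ g : ShiftClass E →ᵇ ℝ, ‖g‖ = ‖f‖ → (∀ x, |g x| ≤ ‖f‖ * h x) → ∀ η > 0,
      ∀ᶠ n in atTop, ∫ x, g x ∂μ - η < ∫ x, g x ∂(μs n) := by
    intro g hgf hg η hη
    have hgs : ∀ x, ‖f‖ * h x + g x ≠ 0 → ε / 2 < x.maxNorm := fun x hx => by
      refine hhs x fun h0 => hx ?_
      have := hg x
      rw [h0, mul_zero] at this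
      rw [h0, abs_nonpos_iff.1 this]
      simp
    have hgint : ∀ m, BoundedlyFinite m → Integrable g m := fun m hm => by
      refine hm.integrable g.continuous.measurable (fun x => g.norm_coe_le_norm x) hε2
        fun x hx => hhs x fun h0 => hx ?_
      have := hg x
      rw [h0, mul_zero] at this
      exact abs_nonpos_iff.1 this
    have hsum : ∀ m, BoundedlyFinite m →
        ∫ x, (‖f‖ * h x + g x) ∂m = ‖f‖ * ∫ x, h x ∂m + ∫ x, g x ∂m := fun m hm => by
      rw [integral_add ((hhint m hm).const_mul _) (hgint m hm), integral_const_mul]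
    have h1 := eventually_lt_integral_of_nonneg hfin hfin' hlip
      (f := fun x => ‖f‖ * h x + g x) ((continuous_const.mul hhL.continuous).add g.continuous)
      (fun x => by linarith [(abs_le.1 (hg x)).1]) (B := ‖f‖ * 1 + ‖f‖)
      (fun x => (abs_add_le _ _).trans (add_le_add (by
        rw [abs_mul, abs_of_nonneg (norm_nonneg _)]
        exact mul_le_mul_of_nonneg_left (hh1 x) (norm_nonneg _))
        (hgf ▸ g.norm_coe_le_norm x))) hε2 hgs
      (a := ∫ x, (‖f‖ * h x + g x) ∂μ - η / 2) (by linarith)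
    filter_upwards [h1, (hhconv.const_mul ‖f‖).eventually
      (gt_mem_nhds (lt_add_of_pos_right _ (half_pos hη)))] with n hn1 hn2
    rw [hsum μ hfin', hsum _ (hfin n)] at hn1
    linarith
  rw [Metric.tendsto_nhds]
  intro η hη
  filter_upwards [lower f rfl hhf η hη,
    lower (-f) (norm_neg f) (fun x => by simpa using hhf x) η hη]
    with n h1 h2
  simp only [BoundedContinuousFunction.coe_neg, Pi.neg_apply, integral_neg] at h2
  rw [Real.dist_eq, abs_lt]
  constructor <;> linarith

end Converse

end MZero

/-! ### The tail process -/

section Excess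

variable {E : Type*} [NormedAddCommGroup E]

/-- A continuous function with values in `[0, 1]` that is positive exactly outside the closed
unit ball. -/
noncomputable def excess (x : E) : ℝ := max 0 (min 1 (‖x‖ - 1))

theorem continuous_excess : Continuous (excess : E → ℝ) := by
  unfold excess
  fun_prop

theorem excess_nonneg (x : E) : 0 ≤ excess x := le_max_left _ _

theorem excess_le_one (x : E) : excess x ≤ 1 := max_le zero_le_one (min_le_left _ _)

theorem excess_pos_iff {x : E} : 0 < excess x ↔ 1 < ‖x‖ := by
  simp [excess]

theorem excess_ne_zero_iff {x : E} : excess x ≠ 0 ↔ 1 < ‖x‖ := by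
  rw [← excess_pos_iff, (excess_nonneg x).lt_iff_ne']

end Excess

section SequenceMeasures

/-- Finite measures on sequences are determined by their projections to finite windows. -/
theorem ext_of_map_window {E : Type*} [MeasurableSpace E] {μ₁ μ₂ : Measure (ℤ → E)}
    [IsFiniteMeasure μ₁] [IsFiniteMeasure μ₂]
    (h : ∀ N : ℕ, μ₁.map (window (-N : ℤ) N) = μ₂.map (window (-N : ℤ) N)) : μ₁ = μ₂ := by
  refine IsProjectiveLimit.unique (P := fun I : Finset ℤ => μ₂.map I.restrict) (fun I => ?_)
    fun I => rfl
  obtain ⟨N, hN⟩ := (I.image Int.natAbs).bddAbove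
  have hmem : ∀ i ∈ I, i ∈ Set.Icc (-N : ℤ) N := fun i hi => by
    have := hN (Finset.mem_coe.2 (Finset.mem_image_of_mem _ hi))
    exact ⟨by omega, by omega⟩
  let ρ : (Set.Icc (-N : ℤ) N → E) → (I → E) := fun x i => x ⟨i, hmem i i.2⟩
  have hρ : Measurable ρ := measurable_pi_lambda _ fun i => measurable_pi_apply _
  have hcomp : (I.restrict : (ℤ → E) → I → E) = ρ ∘ window (-N : ℤ) N := rfl
  rw [hcomp, ← Measure.map_map hρ (measurable_window _ _), h N,
    Measure.map_map hρ (measurable_window _ _)]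
  rfl

theorem isFiniteMeasure_withDensity_of_le_one {S : Type*} [MeasurableSpace S] {μ : Measure S}
    [IsFiniteMeasure μ] {f : S → ℝ} (hf : ∀ x, f x ≤ 1) :
    IsFiniteMeasure (μ.withDensity fun x => ENNReal.ofReal (f x)) := by
  refine isFiniteMeasure_withDensity (ne_of_lt ?_)
  calc ∫⁻ x, ENNReal.ofReal (f x) ∂μ ≤ ∫⁻ _, 1 ∂μ :=
        lintegral_mono fun x => by simpa using hf x
    _ < ∞ := by simp

theorem integral_withDensity_ofReal {S : Type*} [MeasurableSpace S] {μ : Measure S}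
    {f : S → ℝ} (hf : Measurable f) (h0 : ∀ x, 0 ≤ f x) (g : S → ℝ) :
    ∫ x, g x ∂(μ.withDensity fun x => ENNReal.ofReal (f x)) = ∫ x, f x * g x ∂μ := by
  rw [integral_withDensity_eq_integral_toReal_smul hf.ennreal_ofReal
    (Eventually.of_forall fun _ => ENNReal.ofReal_lt_top)]
  simp only [ENNReal.toReal_ofReal (h0 _), smul_eq_mul]

theorem window_smul {E : Type*} [NormedAddCommGroup E] [NormedSpace ℝ E] (s t : ℤ) (r : ℝ)
    (x : ℤ → E) : window s t (r • x) = r • window s t x := rfl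

theorem measurableSet_lt_norm {E Ω : Type*} [NormedAddCommGroup E]
    [MeasurableSpace E] [OpensMeasurableSpace E] [MeasurableSpace Ω] {X : Ω → ℤ → E}
    (hX : Measurable X) (u : ℝ) (j : ℤ) :
    MeasurableSet {ω | u < ‖X ω j‖} :=
  measurableSet_lt measurable_const ((measurable_pi_apply j).comp hX).norm

/-- Translation of the time. -/
def translate {E : Type*} (k : ℤ) (x : ℤ → E) : ℤ → E := fun j => x (j + k)

theorem measurable_translate {E : Type*} [MeasurableSpace E] (k : ℤ) :
    Measurable (translate (E := E) k) :=
  measurable_pi_lambda _ fun _ => measurable_pi_apply _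

theorem measurableSet_forall_norm_le {E : Type*} [NormedAddCommGroup E]
    [MeasurableSpace E] [OpensMeasurableSpace E] (p : ℤ → Prop) :
    MeasurableSet {y : ℤ → E | ∀ j, p j → ‖y j‖ ≤ 1} := by
  simp only [Set.ofPred_forall]
  exact MeasurableSet.iInter fun j => MeasurableSet.iInter fun _ =>
    measurableSet_le (measurable_pi_apply j).norm measurable_const

theorem finite_one_lt_norm {E : Type*} [NormedAddCommGroup E] {y : ℤ → E}
    (hy : y ∈ ellZero E) : {j | 1 < ‖y j‖}.Finite := by
  have h := (show Tendsto _ _ _ from hy).eventually (gt_mem_nhds zero_lt_one)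
  rw [eventually_cofinite] at h
  exact h.subset fun j (hj : 1 < ‖y j‖) => not_lt.2 hj.le

end SequenceMeasures

section Tail

theorem IsTailProcess.ae_one_lt_norm {E : Type*} [NormedAddCommGroup E] [NormedSpace ℝ E]
    [MeasurableSpace E] [OpensMeasurableSpace E] {Ω : Type*} [MeasurableSpace Ω] {P : Measure Ω}
    {Ω' : Type*} [MeasurableSpace Ω'] {P' : Measure Ω'} [IsProbabilityMeasure P']
    {X : Ω → ℤ → E} {Y : Ω' → ℤ → E} {α : ℝ} (hXY : IsTailProcess P X α P' Y) (hY : Measurable Y) :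
    ∀ᵐ y ∂(P'.map Y), 1 < ‖y 0‖ := by
  have hm : MeasurableSet {y : ℤ → E | 1 < ‖y 0‖} :=
    measurableSet_lt measurable_const (measurable_pi_apply 0).norm
  rw [ae_map_iff hY.aemeasurable hm]
  have h1 := hXY.pareto 1 le_rfl
  rw [Real.one_rpow] at h1
  have h2 : P' {ω | 1 < ‖Y ω 0‖} = 1 := by
    rw [measureReal_def] at h1
    rw [← ENNReal.ofReal_toReal (measure_ne_top P' _), h1, ENNReal.ofReal_one]
  exact (prob_compl_eq_zero_iff (measurableSet_lt_norm hY 1 0)).2 h2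

theorem IsTailProcess.measureReal_pos {E : Type*} [NormedAddCommGroup E] [NormedSpace ℝ E]
    [MeasurableSpace E] {Ω : Type*} [MeasurableSpace Ω] {P : Measure Ω} [IsProbabilityMeasure P]
    {Ω' : Type*} [MeasurableSpace Ω'] {P' : Measure Ω'} [IsProbabilityMeasure P']
    {X : Ω → ℤ → E} {Y : Ω' → ℤ → E} {α : ℝ} (hXY : IsTailProcess P X α P' Y) (hY : Measurable Y)
    (u : ℝ) : 0 < P.real {ω | u < ‖X ω 0‖} := by
  refine measureReal_nonneg.lt_of_ne' fun h => ?_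
  rw [measureReal_eq_zero_iff] at h
  have h1 := hXY.tendsto 0 0 le_rfl (BoundedContinuousFunction.const _ 1)
  have hprob : IsProbabilityMeasure (P'.map (fun ω => window 0 0 (Y ω))) :=
    Measure.isProbabilityMeasure_map ((measurable_window 0 0).comp hY).aemeasurable
  have h2 : Tendsto (fun v : ℝ =>
      ∫ x, BoundedContinuousFunction.const (Set.Icc (0 : ℤ) 0 → E) (1 : ℝ) x
        ∂((P[|{ω | v < ‖X ω 0‖}]).map fun ω => v⁻¹ • window 0 0 (X ω))) atTop (𝓝 0) := by
    refine tendsto_nhds_of_eventually_eq ?_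
    filter_upwards [eventually_ge_atTop u] with v hv
    have : P {ω | v < ‖X ω 0‖} = 0 :=
      measure_mono_null (fun ω (hω : v < ‖X ω 0‖) => hv.trans_lt hω) h
    rw [cond_eq_zero_of_meas_eq_zero this, Measure.map_zero, integral_zero_measure]
  have := tendsto_nhds_unique h1 h2
  simp at this

variable {E : Type*} [NormedAddCommGroup E] [NormedSpace ℝ E] [FiniteDimensional ℝ E]
  [MeasurableSpace E] [BorelSpace E]
  {Ω : Type*} [MeasurableSpace Ω] {P : Measure Ω}
  {Ω' : Type*} [MeasurableSpace Ω'] {P' : Measure Ω'}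
  {X : Ω → ℤ → E} {Y : Ω' → ℤ → E} {α : ℝ}

/-- Convergence of the expectations of functions of finitely many coordinates that vanish
unless the coordinate at time zero is large. -/
theorem IsTailProcess.tendsto_integral_div (hXY : IsTailProcess P X α P' Y) (hX : Measurable X)
    (hY : Measurable Y) {s t : ℤ} (hst : s ≤ t) {Φ : (ℤ → E) → ℝ} (hΦ : Continuous Φ) {B : ℝ}
    (hB : ∀ x, |Φ x| ≤ B) (hdep : ∀ x y, (∀ j ∈ Set.Icc s t, x j = y j) → Φ x = Φ y)
    (h0 : ∀ x, Φ x ≠ 0 → 1 < ‖x 0‖) :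
    Tendsto (fun u : ℝ => (∫ ω, Φ (u⁻¹ • X ω) ∂P) / P.real {ω | u < ‖X ω 0‖}) atTop
      (𝓝 (∫ ω, Φ (Y ω) ∂P')) := by
  have hw : ∀ x, Φ (extend s t (window s t x)) = Φ x := fun x =>
    hdep _ _ fun j hj => extend_apply_of_mem _ hj
  let φ : (Set.Icc s t → E) →ᵇ ℝ := BoundedContinuousFunction.ofNormedAddCommGroup
    (fun x => Φ (extend s t x)) (hΦ.comp (continuous_extend s t)) B fun x => hB _
  have hφ : ∀ x, φ (window s t x) = Φ x := hw
  have h1 := hXY.tendsto s t hst φ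
  have hmY : Measurable fun ω => window s t (Y ω) := (measurable_window s t).comp hY
  rw [integral_map hmY.aemeasurable φ.continuous.aestronglyMeasurable] at h1
  simp only [hφ] at h1
  refine h1.congr' ?_
  filter_upwards [eventually_gt_atTop 0] with u hu
  have hm : Measurable fun ω => u⁻¹ • window s t (X ω) :=
    ((measurable_window s t).comp hX).const_smul u⁻¹
  rw [integral_map hm.aemeasurable φ.continuous.aestronglyMeasurable]
  simp only [← window_smul, hφ]
  rw [ProbabilityTheory.cond, integral_smul_measure, ENNReal.toReal_inv, smul_eq_mul,
    div_eq_inv_mul, setIntegral_eq_integral_of_forall_compl_eq_zero]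
  · rfl
  · intro ω hω
    by_contra hne
    refine hω ?_
    have h2 := h0 _ hne
    rw [Pi.smul_apply, norm_smul, norm_inv, Real.norm_of_nonneg hu.le, ← div_eq_inv_mul,
      one_lt_div hu] at h2
    exact h2

variable [IsProbabilityMeasure P']

/-- On sequences with a large coordinate at time zero, the law of the tail process agrees with
the tail measure. -/
theorem IsTailProcess.withDensity_eq (hXY : IsTailProcess P X α P' Y) (hX : Measurable X)
    (hY : Measurable Y) {ν : Measure (ℤ → E)} (hν : IsTailMeasure P X ν) :
    (P'.map Y).withDensity (fun y => ENNReal.ofReal (excess (y 0))) =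
      ν.withDensity (fun y => ENNReal.ofReal (excess (y 0))) := by
  have hP : IsProbabilityMeasure (P'.map Y) := Measure.isProbabilityMeasure_map hY.aemeasurable
  have hgc : Continuous fun y : ℤ → E => excess (y 0) :=
    continuous_excess.comp (continuous_apply 0)
  have hfin := isFiniteMeasure_withDensity_of_le_one (μ := P'.map Y)
    (f := fun y : ℤ → E => excess (y 0)) fun y => excess_le_one _
  set m₁ := (P'.map Y).withDensity (fun y => ENNReal.ofReal (excess (y 0))) with hm₁
  set m₂ := ν.withDensity (fun y => ENNReal.ofReal (excess (y 0))) with hm₂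
  have hwin : ∀ N : ℕ, m₁.map (window (-N : ℤ) N) = m₂.map (window (-N : ℤ) N) := by
    intro N
    have hst : (-N : ℤ) ≤ N := by omega
    have h0mem : (0 : ℤ) ∈ Set.Icc (-N : ℤ) N := ⟨by omega, by omega⟩
    have hwm := measurable_window (E := E) (-N : ℤ) N
    let o : Set.Icc (-N : ℤ) N := ⟨0, h0mem⟩
    have hT := hν.projection (-N) N hst
    have hclosed : IsClosed {x : Set.Icc (-N : ℤ) N → E | 1 ≤ ‖x o‖} :=
      isClosed_le continuous_const (continuous_apply o).norm
    have hcompact : IsFiniteMeasureOnCompacts (m₂.map (window (-N : ℤ) N)) := by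
      refine ⟨fun K hK => ?_⟩
      have hK' := hT.radon _ (hK.inter_right hclosed) (fun h => by
        have := h.2
        simp only [Set.mem_ofPred_eq, Pi.zero_apply, norm_zero] at this
        linarith)
      refine lt_of_le_of_lt ?_ hK'
      have hKm := (hK.inter_right hclosed).measurableSet
      have hsub : (K ∩ {x : Set.Icc (-N : ℤ) N → E | 1 ≤ ‖x o‖}) ∩ {0}ᶜ =
          K ∩ {x : Set.Icc (-N : ℤ) N → E | 1 ≤ ‖x o‖} := by
        refine Set.inter_eq_left.2 fun x hx h => ?_
        have := hx.2
        rw [Set.mem_singleton_iff.1 h] at this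
        simp only [Set.mem_ofPred_eq, Pi.zero_apply, norm_zero] at this
        linarith
      rw [Measure.restrict_apply hKm, hsub, Measure.map_apply hwm hKm,
        Measure.map_apply hwm hK.measurableSet, hm₂,
        withDensity_apply _ (hwm hK.measurableSet), ← setLIntegral_one,
        ← lintegral_indicator (hwm hK.measurableSet), ← lintegral_indicator (hwm hKm)]
      refine lintegral_mono fun x => ?_
      by_cases hxK : window (-N : ℤ) N x ∈ K
      · by_cases hx : 1 ≤ ‖x 0‖
        · rw [Set.indicator_of_mem (by exact hxK), Set.indicator_of_mem (by exact ⟨hxK, hx⟩)]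
          simpa using excess_le_one (x 0)
        · have : excess (x 0) = 0 := by
            by_contra h
            exact hx (excess_ne_zero_iff.1 h).le
          refine (Set.indicator_le_self _ _ _).trans ?_
          rw [this, ENNReal.ofReal_zero]
          exact zero_le
      · rw [Set.indicator_of_notMem (by exact hxK)]
        exact zero_le
    have hfinite : IsFiniteMeasure (m₁.map (window (-N : ℤ) N)) :=
      Measure.isFiniteMeasure_map _ _
    have hloc := isLocallyFiniteMeasure_of_isFiniteMeasureOnCompacts
      (μ := m₂.map (window (-N : ℤ) N))
    refine Measure.ext_of_integral_eq_on_compactlySupported fun f => ?_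
    obtain ⟨B, hB⟩ := f.hasCompactSupport.exists_bound_of_continuous f.continuous
    have hfc : Continuous fun x => f x := f.continuous
    have hφc : Continuous fun x : Set.Icc (-N : ℤ) N → E => excess (x o) * f x :=
      (continuous_excess.comp (continuous_apply o)).mul f.continuous
    have hφ0 : ∀ x : Set.Icc (-N : ℤ) N → E, excess (x o) * f x ≠ 0 → 1 < ‖x o‖ := fun x hx =>
      excess_ne_zero_iff.1 (left_ne_zero_of_mul hx)
    have hwc : Continuous (window (E := E) (-N : ℤ) N) :=
      continuous_pi fun i => continuous_apply _
    have hΦc : Continuous fun x : ℤ → E => excess (x 0) * f (window (-N : ℤ) N x) :=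
      hgc.mul (hfc.comp hwc)
    rw [integral_map hwm.aemeasurable hfc.aestronglyMeasurable,
      integral_map hwm.aemeasurable hfc.aestronglyMeasurable,
      integral_withDensity_ofReal hgc.measurable (fun _ => excess_nonneg _),
      integral_withDensity_ofReal hgc.measurable (fun _ => excess_nonneg _),
      integral_map hY.aemeasurable
        hΦc.aestronglyMeasurable]
    have h1 := hXY.tendsto_integral_div hX hY hst
      (Φ := fun x => excess (x 0) * f (window (-N : ℤ) N x))
      hΦc (B := B) (fun x => by
        rw [abs_mul, abs_of_nonneg (excess_nonneg _), ← Real.norm_eq_abs]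
        exact (mul_le_of_le_one_left (norm_nonneg _) (excess_le_one _)).trans (hB _))
      (fun x y hxy => by
        have : window (-N : ℤ) N x = window (-N : ℤ) N y := funext fun i => hxy i i.2
        rw [this, hxy 0 h0mem])
      (fun x hx => excess_ne_zero_iff.1 (left_ne_zero_of_mul hx))
    have h2 := hT.tendsto (fun x => excess (x o) * f x) hφc f.hasCompactSupport.mul_left (by
      intro h
      have : (1 : ℝ) ≤ ‖(0 : Set.Icc (-N : ℤ) N → E) o‖ :=
        closure_minimal (fun x (hx : _ ≠ _) => (hφ0 x hx).le) hclosed h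
      rw [Pi.zero_apply, norm_zero] at this
      linarith)
    rw [setIntegral_eq_integral_of_forall_compl_eq_zero, integral_map hwm.aemeasurable
      hφc.aestronglyMeasurable] at h2
    · exact tendsto_nhds_unique h1 h2
    · intro x hx
      by_contra h
      have := hφ0 x h
      rw [Set.notMem_compl_iff, Set.mem_singleton_iff] at hx
      rw [hx, Pi.zero_apply, norm_zero] at this
      linarith
  have hfin' : IsFiniteMeasure m₂ := by
    refine ⟨?_⟩
    have h := congrArg (fun m => m Set.univ) (hwin 0)
    simp only [Measure.map_apply (measurable_window _ _) MeasurableSet.univ,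
      Set.preimage_univ] at h
    rw [← h]
    exact measure_lt_top _ _
  exact ext_of_map_window hwin

theorem IsTailProcess.ae_mem_ellZero (hXY : IsTailProcess P X α P' Y) (hX : Measurable X)
    (hY : Measurable Y) {ν : Measure (ℤ → E)} (hν : IsTailMeasure P X ν)
    (hν_supp : ν (ellZero E)ᶜ = 0) : ∀ᵐ y ∂(P'.map Y), y ∈ ellZero E := by
  have hg : Measurable fun y : ℤ → E => ENNReal.ofReal (excess (y 0)) :=
    (continuous_excess.comp (continuous_apply 0)).measurable.ennreal_ofReal
  have h1 := withDensity_absolutelyContinuous ν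
    (fun y : ℤ → E => ENNReal.ofReal (excess (y 0))) hν_supp
  rw [← hXY.withDensity_eq hX hY hν, withDensity_apply_eq_zero hg] at h1
  filter_upwards [measure_eq_zero_iff_ae_notMem.1 h1, hXY.ae_one_lt_norm hY] with y hy1 hy2
  by_contra hc
  exact hy1 ⟨by simpa using excess_pos_iff.2 hy2, hc⟩

theorem IsTailProcess.map_translate_withDensity (hXY : IsTailProcess P X α P' Y)
    (hX : Measurable X) (hstat : IsStationary P X) (hY : Measurable Y) (k : ℤ) :
    ((P'.map Y).withDensity
        (fun y => ENNReal.ofReal (excess (y 0) * excess (y k)))).map (translate k) =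
      (P'.map Y).withDensity (fun y => ENNReal.ofReal (excess (y 0) * excess (y (-k)))) := by
  have hP : IsProbabilityMeasure (P'.map Y) := Measure.isProbabilityMeasure_map hY.aemeasurable
  have hgc : ∀ k : ℤ, Continuous fun y : ℤ → E => excess (y 0) * excess (y k) := fun k =>
    (continuous_excess.comp (continuous_apply 0)).mul (continuous_excess.comp (continuous_apply k))
  have hg0 : ∀ (k : ℤ) (y : ℤ → E), 0 ≤ excess (y 0) * excess (y k) := fun k y =>
    mul_nonneg (excess_nonneg _) (excess_nonneg _)
  have hg1 : ∀ (k : ℤ) (y : ℤ → E), excess (y 0) * excess (y k) ≤ 1 := fun k y =>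
    mul_le_one₀ (excess_le_one _) (excess_nonneg _) (excess_le_one _)
  have hfin := fun k : ℤ => isFiniteMeasure_withDensity_of_le_one (μ := P'.map Y) (hg1 k)
  have hf1 := hfin k
  have hf2 := hfin (-k)
  have hθ := measurable_translate (E := E) k
  have hθc : Continuous (translate (E := E) k) := continuous_pi fun j => continuous_apply _
  refine ext_of_map_window fun N => ?_
  have hwm := measurable_window (E := E) (-N : ℤ) N
  have hwc : Continuous (window (E := E) (-N : ℤ) N) :=
    continuous_pi fun i => continuous_apply _
  refine ext_of_forall_integral_eq_of_IsFiniteMeasure fun φ => ?_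
  have hφc : Continuous fun y : ℤ → E => φ (window (-N : ℤ) N y) := φ.continuous.comp hwc
  have hΦ₁ : Continuous fun y : ℤ → E =>
      excess (y 0) * excess (y k) * φ (window (-N : ℤ) N (translate k y)) :=
    (hgc k).mul (hφc.comp hθc)
  have hΦ₂ : Continuous fun y : ℤ → E =>
      excess (y 0) * excess (y (-k)) * φ (window (-N : ℤ) N y) := (hgc (-k)).mul hφc
  rw [integral_map hwm.aemeasurable φ.continuous.aestronglyMeasurable,
    integral_map hwm.aemeasurable φ.continuous.aestronglyMeasurable,
    integral_map hθ.aemeasurable hφc.aestronglyMeasurable,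
    integral_withDensity_ofReal (hgc k).measurable (hg0 k),
    integral_withDensity_ofReal (hgc (-k)).measurable (hg0 (-k)),
    integral_map hY.aemeasurable hΦ₁.aestronglyMeasurable,
    integral_map hY.aemeasurable hΦ₂.aestronglyMeasurable]
  have hbound : ∀ (k : ℤ) (y : ℤ → E) z, |excess (y 0) * excess (y k) * φ z| ≤ ‖φ‖ :=
    fun k y z => by
      rw [abs_mul, abs_of_nonneg (hg0 k y)]
      exact (mul_le_of_le_one_left (abs_nonneg _) (hg1 k y)).trans (φ.norm_coe_le_norm z)
  have hM : -((N : ℤ) + |k|) ≤ N + |k| := by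
    have := abs_nonneg k
    omega
  have h1 := hXY.tendsto_integral_div hX hY hM hΦ₁ (fun y => hbound k y _)
    (fun x y hxy => by
      have hk := abs_le.1 (le_refl |k|)
      have : window (-N : ℤ) N (translate k x) = window (-N : ℤ) N (translate k y) :=
        funext fun i => hxy _ ⟨by linarith [i.2.1], by linarith [i.2.2]⟩
      rw [this, hxy 0 ⟨by linarith, by linarith⟩, hxy k ⟨by linarith, by linarith⟩])
    (fun x hx => excess_ne_zero_iff.1 (left_ne_zero_of_mul (left_ne_zero_of_mul hx)))
  have h2 := hXY.tendsto_integral_div hX hY hM hΦ₂ (fun y => hbound (-k) y _)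
    (fun x y hxy => by
      have hk := abs_le.1 (le_refl |k|)
      have : window (-N : ℤ) N x = window (-N : ℤ) N y :=
        funext fun i => hxy _ ⟨by linarith [i.2.1], by linarith [i.2.2]⟩
      rw [this, hxy 0 ⟨by linarith, by linarith⟩, hxy (-k) ⟨by linarith, by linarith⟩])
    (fun x hx => excess_ne_zero_iff.1 (left_ne_zero_of_mul (left_ne_zero_of_mul hx)))
  refine tendsto_nhds_unique (h1.congr fun u => ?_) h2
  congr 1
  have hc : Continuous fun x : ℤ → E => excess ((u⁻¹ • x) 0) * excess ((u⁻¹ • x) (-k)) *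
    φ (window (-N : ℤ) N (u⁻¹ • x)) := hΦ₂.comp (continuous_const_smul u⁻¹)
  have hs := congrArg (fun m => ∫ x, excess ((u⁻¹ • x) 0) * excess ((u⁻¹ • x) (-k)) *
    φ (window (-N : ℤ) N (u⁻¹ • x)) ∂m) (hstat k)
  beta_reduce at hs
  have hmX : Measurable fun ω j => X ω (j + k) := hθ.comp hX
  rw [integral_map hmX.aemeasurable hc.aestronglyMeasurable,
    integral_map hX.aemeasurable hc.aestronglyMeasurable] at hs
  rw [← hs]
  refine integral_congr_ae (Eventually.of_forall fun ω => ?_)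
  simp only [Pi.smul_apply, zero_add, neg_add_cancel]
  rw [mul_comm (excess (u⁻¹ • X ω 0))]
  rfl

theorem IsTailProcess.ae_translate_mem (hXY : IsTailProcess P X α P' Y) (hX : Measurable X)
    (hstat : IsStationary P X) (hY : Measurable Y) {A : Set (ℤ → E)} (hA : MeasurableSet A)
    (h0 : P'.map Y A = 0) :
    ∀ᵐ y ∂(P'.map Y), ∀ k : ℤ, translate k y ∈ A → ‖y k‖ ≤ 1 := by
  rw [ae_all_iff]
  intro k
  have hg : Measurable fun y : ℤ → E => ENNReal.ofReal (excess (y 0) * excess (y k)) :=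
    ((continuous_excess.comp (continuous_apply 0)).mul
      (continuous_excess.comp (continuous_apply k))).measurable.ennreal_ofReal
  have h1 := withDensity_absolutelyContinuous (P'.map Y)
    (fun y => ENNReal.ofReal (excess (y 0) * excess (y (-k)))) h0
  rw [← hXY.map_translate_withDensity hX hstat hY k,
    Measure.map_apply (measurable_translate k) hA, withDensity_apply_eq_zero hg] at h1
  filter_upwards [measure_eq_zero_iff_ae_notMem.1 h1, hXY.ae_one_lt_norm hY] with y hy1 hy2 hyA
  by_contra! hc
  refine hy1 ⟨?_, hyA⟩
  simpa using mul_pos (excess_pos_iff.2 hy2) (excess_pos_iff.2 hc)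

theorem IsTailProcess.measure_past_ne_zero (hXY : IsTailProcess P X α P' Y) (hX : Measurable X)
    (hstat : IsStationary P X) (hY : Measurable Y)
    (hl : ∀ᵐ y ∂(P'.map Y), y ∈ ellZero E) :
    P' {ω | ∀ j : ℤ, j ≤ -1 → ‖Y ω j‖ ≤ 1} ≠ 0 := by
  intro h0
  have hP : IsProbabilityMeasure (P'.map Y) := Measure.isProbabilityMeasure_map hY.aemeasurable
  have hA := measurableSet_forall_norm_le (E := E) (fun j => j ≤ -1)
  have h1 := hXY.ae_translate_mem hX hstat hY hA (by rw [Measure.map_apply hY hA]; exact h0)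
  obtain ⟨y, hy, hyl, hy0⟩ := (h1.and (hl.and (hXY.ae_one_lt_norm hY))).exists
  obtain ⟨k, hk, hmin⟩ := (finite_one_lt_norm hyl).exists_minimalFor id _ ⟨0, hy0⟩
  refine absurd (hy k fun j hj => ?_) (not_le.2 hk)
  by_contra! hc
  have := hmin (j := j + k) hc (by simp only [id]; omega)
  simp only [id] at this
  omega

theorem IsTailProcess.extremalIndex_pos (hXY : IsTailProcess P X α P' Y) (hX : Measurable X)
    (hstat : IsStationary P X) (hY : Measurable Y)
    (hl : ∀ᵐ y ∂(P'.map Y), y ∈ ellZero E) : 0 < extremalIndex P' Y := by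
  refine measureReal_nonneg.lt_of_ne' fun h0 => ?_
  rw [measureReal_eq_zero_iff] at h0
  have hP : IsProbabilityMeasure (P'.map Y) := Measure.isProbabilityMeasure_map hY.aemeasurable
  have hA := measurableSet_forall_norm_le (E := E) (fun j => 1 ≤ j)
  have h1 := hXY.ae_translate_mem hX hstat hY hA (by rw [Measure.map_apply hY hA]; exact h0)
  obtain ⟨y, hy, hyl, hy0⟩ := (h1.and (hl.and (hXY.ae_one_lt_norm hY))).exists
  obtain ⟨k, hk, hmax⟩ := (finite_one_lt_norm hyl).exists_maximalFor id _ ⟨0, hy0⟩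
  refine absurd (hy k fun j hj => ?_) (not_le.2 hk)
  by_contra! hc
  have := hmax (j := j + k) hc (by simp only [id]; omega)
  simp only [id] at this
  omega

end Tail

/-! ### The radial measure -/

theorem radialMeasure_Ioi {α u : ℝ} (hα : 0 < α) (hu : 0 < u) :
    radialMeasure α (Set.Ioi u) = ENNReal.ofReal (u ^ (-α)) := by
  have hexp : -α - 1 < -1 := by linarith
  have hsub : Set.Ioi u ∩ Set.Ioi 0 = Set.Ioi u :=
    Set.inter_eq_left.2 (Set.Ioi_subset_Ioi hu.le)
  rw [radialMeasure, withDensity_apply _ measurableSet_Ioi,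
    Measure.restrict_restrict measurableSet_Ioi, hsub,
    ← ofReal_integral_eq_lintegral_ofReal ((integrableOn_Ioi_rpow_of_lt hexp hu).const_mul α),
    integral_const_mul, integral_Ioi_rpow_of_lt hexp hu]
  · congr 1
    rw [sub_add_cancel]
    field_simp
  · filter_upwards [ae_restrict_mem measurableSet_Ioi] with r hr
    have := hu.trans hr
    positivity

theorem ae_pos_radialMeasure (α : ℝ) : ∀ᵐ r ∂(radialMeasure α), 0 < r :=
  withDensity_absolutelyContinuous _ _ (ae_restrict_mem measurableSet_Ioi)

instance (α : ℝ) : SFinite (radialMeasure α) := by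
  unfold radialMeasure
  infer_instance

theorem measureReal_mul_integral_cond {S : Type*} [MeasurableSpace S] (μ : Measure S)
    [IsFiniteMeasure μ] (B : Set S) (f : S → ℝ) :
    μ.real B * ∫ x, f x ∂(μ[|B]) = ∫ x in B, f x ∂μ := by
  rw [ProbabilityTheory.cond, integral_smul_measure, ENNReal.toReal_inv, smul_eq_mul, ← mul_assoc]
  by_cases h : μ B = 0
  · rw [Measure.restrict_eq_zero.2 h, integral_zero_measure, mul_zero]
  · rw [measureReal_def, mul_inv_cancel₀ (ENNReal.toReal_ne_zero.2 ⟨h, measure_ne_top _ _⟩),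
      one_mul]

theorem extremalIndex_nonneg {E : Type*} [NormedAddCommGroup E] {Ω' : Type*}
    [MeasurableSpace Ω'] {P' : Measure Ω'} {Y : Ω' → ℤ → E} : 0 ≤ extremalIndex P' Y :=
  measureReal_nonneg

theorem ae_prod_lawQ {E : Type*} [NormedAddCommGroup E] [NormedSpace ℝ E]
    [MeasurableSpace E] {Ω' : Type*} [MeasurableSpace Ω'] {P' : Measure Ω'} {Y : Ω' → ℤ → E}
    {α : ℝ} [IsProbabilityMeasure (lawQ P' Y)]
    (hQ : ∀ᵐ q ∂(lawQ P' Y), q ∈ ellZero E ∧ seqMax q = 1) :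
    ∀ᵐ p ∂((radialMeasure α).prod (lawQ P' Y)), 0 < p.1 ∧ p.2 ∈ ellZero E ∧
      (toShiftClass p.2).maxNorm = 1 ∧ (toShiftClass (p.1 • p.2)).maxNorm = p.1 := by
  filter_upwards [Measure.quasiMeasurePreserving_fst.ae (ae_pos_radialMeasure α),
    Measure.quasiMeasurePreserving_snd.ae hQ] with p h1 h2
  refine ⟨h1, h2.1, ?_, ?_⟩
  · rw [maxNorm_toShiftClass h2.1, h2.2]
  · rw [maxNorm_toShiftClass (smul_mem_ellZero _ h2.1), seqMax_smul, h2.2, mul_one,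
      abs_of_pos h1]

section Law

variable {E : Type*} [NormedAddCommGroup E] [NormedSpace ℝ E]
  [MeasurableSpace E] [BorelSpace E] [SecondCountableTopology E]

theorem measurable_smul_seq : Measurable fun p : ℝ × (ℤ → E) => p.1 • p.2 :=
  measurable_pi_lambda _ fun j =>
    measurable_fst.smul ((measurable_pi_apply j).comp measurable_snd)

theorem measurable_toShiftClass_smul :
    Measurable fun p : ℝ × (ℤ → E) => toShiftClass (p.1 • p.2) :=
  measurable_toShiftClass.comp measurable_smul_seq

theorem measurable_normalize_seq : Measurable fun x : ℤ → E => (seqMax x)⁻¹ • x :=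
  measurable_smul_seq.comp (measurable_seqMax.inv.prodMk measurable_id)

/-! ### The cluster measure -/

section Cluster

variable {Ω : Type*} [MeasurableSpace Ω] {P : Measure Ω} [IsProbabilityMeasure P]
  {X : Ω → ℤ → E}

theorem measurable_smul_block (hX : Measurable X) (c : ℝ) (m : ℕ) :
    Measurable fun ω => toShiftClass (c⁻¹ • block m (X ω)) :=
  measurable_toShiftClass.comp (measurable_smul_seq.comp
    (measurable_const.prodMk ((measurable_block m).comp hX)))

theorem boundedlyFinite_clusterMeasure (hX : Measurable X) {c : ℝ} (m : ℕ)
    (hpos : 0 < P.real {ω | c < ‖X ω 0‖}) : BoundedlyFinite (clusterMeasure P X c m) := by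
  rintro A hA ⟨ε, hε, hAε⟩
  rw [clusterMeasure, Measure.smul_apply, smul_eq_mul,
    Measure.map_apply (measurable_smul_block hX c m) hA]
  rcases Nat.eq_zero_or_pos m with rfl | hm
  · have hempty : (fun ω => toShiftClass (c⁻¹ • block 0 (X ω))) ⁻¹' A = ∅ := by
      refine Set.eq_empty_of_forall_notMem fun ω hω => ?_
      have h1 := hAε _ hω
      have h2 : block 0 (X ω) = 0 := funext fun j => if_neg fun h => by
        have := h.1.trans h.2
        norm_num at this
      rw [maxNorm_toShiftClass (smul_mem_ellZero _ (block_mem_ellZero _ _)), h2, seqMax_smul] at h1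
      simp only [seqMax, Pi.zero_apply, norm_zero, ciSup_const, mul_zero] at h1
      linarith
    rw [hempty, measure_empty, mul_zero]
    exact ENNReal.zero_lt_top
  · refine ENNReal.mul_lt_top (ENNReal.inv_lt_top.2 (ENNReal.mul_pos ?_ ?_)) (measure_lt_top _ _)
    · exact_mod_cast hm.ne'
    · intro h
      rw [measureReal_def, h, ENNReal.toReal_zero] at hpos
      exact lt_irrefl _ hpos

theorem setIntegral_clusterMeasure (hX : Measurable X) {c u : ℝ} (hc : 0 < c) (hu : 0 < u) (m : ℕ)
    (F : ShiftClass E →ᵇ ℝ) :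
    ∫ x in {x | u < x.maxNorm}, F (ShiftClass.normalize u x) ∂(clusterMeasure P X c m) =
      P.real {ω | c * u < seqMax (block m (X ω))} / ((m : ℝ) * P.real {ω | c < ‖X ω 0‖}) *
        ∫ x, F x ∂((P[|{ω | c * u < seqMax (block m (X ω))}]).map fun ω =>
          toShiftClass ((seqMax (block m (X ω)))⁻¹ • block m (X ω))) := by
  have hms := ShiftClass.measurableSet_lt_maxNorm (E := E) u
  have hZ := measurable_smul_block (X := X) hX c m
  have hb : Measurable fun ω => block m (X ω) := (measurable_block m).comp hX
  have hZ' : Measurable fun ω => toShiftClass ((seqMax (block m (X ω)))⁻¹ • block m (X ω)) :=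
    measurable_toShiftClass.comp (measurable_normalize_seq.comp hb)
  have hFc : Continuous fun x => F (ShiftClass.normalize u x) :=
    F.continuous.comp (ShiftClass.continuous_normalize hu)
  have hB : MeasurableSet {ω | c * u < seqMax (block m (X ω))} :=
    measurableSet_lt measurable_const (measurable_seqMax.comp hb)
  have hnorm : ∀ ω, (toShiftClass (c⁻¹ • block m (X ω))).maxNorm =
      c⁻¹ * seqMax (block m (X ω)) := fun ω => by
    rw [maxNorm_toShiftClass (smul_mem_ellZero _ (block_mem_ellZero _ _)), seqMax_smul,
      abs_of_pos (inv_pos.2 hc)]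
  have hset : (fun ω => toShiftClass (c⁻¹ • block m (X ω))) ⁻¹' {x | u < x.maxNorm} =
      {ω | c * u < seqMax (block m (X ω))} := by
    ext ω
    rw [Set.mem_preimage, Set.mem_ofPred_eq, Set.mem_ofPred_eq, hnorm, ← div_eq_inv_mul,
      lt_div_iff₀ hc, mul_comm]
  rw [clusterMeasure, Measure.restrict_smul, integral_smul_measure,
    setIntegral_map hms hFc.measurable.aestronglyMeasurable hZ.aemeasurable, hset,
    integral_map hZ'.aemeasurable F.continuous.measurable.aestronglyMeasurable,
    div_mul_eq_mul_div, measureReal_mul_integral_cond, ENNReal.toReal_inv, ENNReal.toReal_mul,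
    ENNReal.toReal_natCast, smul_eq_mul, div_eq_inv_mul]
  congr 1
  refine setIntegral_congr_fun hB fun ω hω => ?_
  rw [Set.mem_ofPred_eq] at hω
  have hs : 0 < seqMax (block m (X ω)) := (mul_pos hc hu).trans hω
  have hle : u ≤ (toShiftClass (c⁻¹ • block m (X ω))).maxNorm := by
    rw [hnorm, ← div_eq_inv_mul, le_div_iff₀ hc, mul_comm]
    exact hω.le
  rw [ShiftClass.normalize_of_le hle, hnorm, ← toShiftClass_smul _
    (smul_mem_ellZero _ (block_mem_ellZero _ _)), smul_smul, mul_inv, inv_inv,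
    mul_comm c, mul_assoc, mul_inv_cancel₀ hc.ne', mul_one]

end Cluster

/-! ### The limit measure -/

section NuStar

variable {Ω' : Type*} [MeasurableSpace Ω'] {P' : Measure Ω'}
  {Y : Ω' → ℤ → E}

theorem isProbabilityMeasure_lawQ [IsFiniteMeasure P'] (hY : Measurable Y)
    (h : P' {ω | ∀ j : ℤ, j ≤ -1 → ‖Y ω j‖ ≤ 1} ≠ 0) : IsProbabilityMeasure (lawQ P' Y) := by
  have := cond_isProbabilityMeasure h
  exact Measure.isProbabilityMeasure_map (measurable_normalize_seq.comp hY).aemeasurable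

theorem ae_lawQ (hY : Measurable Y) (hl : ∀ᵐ y ∂(P'.map Y), y ∈ ellZero E)
    (h0 : ∀ᵐ y ∂(P'.map Y), 1 < ‖y 0‖) :
    ∀ᵐ q ∂(lawQ P' Y), q ∈ ellZero E ∧ seqMax q = 1 := by
  have hm : MeasurableSet {q : ℤ → E | q ∈ ellZero E ∧ seqMax q = 1} :=
    measurableSet_ellZero.inter (measurable_seqMax (measurableSet_singleton 1))
  have hQ : Measurable fun ω => (seqMax (Y ω))⁻¹ • Y ω := measurable_normalize_seq.comp hY
  rw [lawQ, ae_map_iff hQ.aemeasurable hm]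
  refine cond_absolutelyContinuous.ae_le ?_
  filter_upwards [ae_of_ae_map hY.aemeasurable hl, ae_of_ae_map hY.aemeasurable h0] with ω h1 h2
  have hpos : 0 < seqMax (Y ω) := by linarith [norm_le_seqMax h1 0]
  exact ⟨smul_mem_ellZero _ h1, by
    rw [seqMax_smul, abs_of_pos (inv_pos.2 hpos), inv_mul_cancel₀ hpos.ne']⟩

variable {α : ℝ}

theorem map_nuStar : (nuStar α P' Y).map toShiftClass = ENNReal.ofReal (extremalIndex P' Y) •
    ((radialMeasure α).prod (lawQ P' Y)).map fun p => toShiftClass (p.1 • p.2) := by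
  rw [nuStar, Measure.map_smul, Measure.map_map measurable_toShiftClass measurable_smul_seq]
  rfl

theorem map_nuStar_lt_maxNorm (hα : 0 < α) [IsProbabilityMeasure (lawQ P' Y)]
    (hQ : ∀ᵐ q ∂(lawQ P' Y), q ∈ ellZero E ∧ seqMax q = 1) {u : ℝ} (hu : 0 < u) :
    (nuStar α P' Y).map toShiftClass {x | u < x.maxNorm} =
      ENNReal.ofReal (extremalIndex P' Y) * ENNReal.ofReal (u ^ (-α)) := by
  have hset : (fun p : ℝ × (ℤ → E) => toShiftClass (p.1 • p.2)) ⁻¹' {x | u < x.maxNorm}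
      =ᵐ[(radialMeasure α).prod (lawQ P' Y)] Set.Ioi u ×ˢ Set.univ := by
    filter_upwards [ae_prod_lawQ hQ] with p hp
    refine propext ?_
    change u < (toShiftClass (p.1 • p.2)).maxNorm ↔ p.1 ∈ Set.Ioi u ∧ p.2 ∈ Set.univ
    rw [hp.2.2.2]
    simp
  rw [map_nuStar, Measure.smul_apply, smul_eq_mul,
    Measure.map_apply measurable_toShiftClass_smul
      (ShiftClass.measurableSet_lt_maxNorm u), measure_congr hset, Measure.prod_prod,
    radialMeasure_Ioi hα hu, measure_univ, mul_one]

theorem map_nuStar_real_lt_maxNorm (hα : 0 < α) [IsProbabilityMeasure (lawQ P' Y)]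
    (hQ : ∀ᵐ q ∂(lawQ P' Y), q ∈ ellZero E ∧ seqMax q = 1) {u : ℝ} (hu : 0 < u) :
    ((nuStar α P' Y).map toShiftClass).real {x | u < x.maxNorm} =
      extremalIndex P' Y * u ^ (-α) := by
  rw [measureReal_def, map_nuStar_lt_maxNorm hα hQ hu, ENNReal.toReal_mul,
    ENNReal.toReal_ofReal extremalIndex_nonneg, ENNReal.toReal_ofReal (Real.rpow_nonneg hu.le _)]

theorem boundedlyFinite_map_nuStar (hα : 0 < α) [IsProbabilityMeasure (lawQ P' Y)]
    (hQ : ∀ᵐ q ∂(lawQ P' Y), q ∈ ellZero E ∧ seqMax q = 1) :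
    BoundedlyFinite ((nuStar α P' Y).map toShiftClass) := by
  rintro A - ⟨ε, hε, hA⟩
  have hsub : A ⊆ {x | ε < x.maxNorm} := hA
  refine (measure_mono hsub).trans_lt ?_
  rw [map_nuStar_lt_maxNorm hα hQ hε]
  exact ENNReal.mul_lt_top ENNReal.ofReal_lt_top ENNReal.ofReal_lt_top

theorem setIntegral_map_nuStar (hα : 0 < α) [IsProbabilityMeasure (lawQ P' Y)]
    (hQ : ∀ᵐ q ∂(lawQ P' Y), q ∈ ellZero E ∧ seqMax q = 1) {u : ℝ} (hu : 0 < u)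
    (F : ShiftClass E →ᵇ ℝ) :
    ∫ x in {x | u < x.maxNorm}, F (ShiftClass.normalize u x)
        ∂((nuStar α P' Y).map toShiftClass) =
      extremalIndex P' Y * u ^ (-α) * ∫ x, F x ∂((lawQ P' Y).map toShiftClass) := by
  have hms := ShiftClass.measurableSet_lt_maxNorm (E := E) u
  have hT := measurable_toShiftClass_smul (E := E)
  have hFc : Continuous fun x => F (ShiftClass.normalize u x) :=
    F.continuous.comp (ShiftClass.continuous_normalize hu)
  rw [map_nuStar, Measure.restrict_smul, integral_smul_measure,
    setIntegral_map hms hFc.measurable.aestronglyMeasurable hT.aemeasurable,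
    ENNReal.toReal_ofReal extremalIndex_nonneg, smul_eq_mul, mul_assoc,
    integral_map measurable_toShiftClass.aemeasurable F.continuous.measurable.aestronglyMeasurable,
    ← integral_indicator (hT hms)]
  have hrad : u ^ (-α) = ∫ r, (Set.Ioi u).indicator 1 r ∂(radialMeasure α) := by
    rw [integral_indicator_one measurableSet_Ioi, measureReal_def, radialMeasure_Ioi hα hu,
      ENNReal.toReal_ofReal (Real.rpow_nonneg hu.le _)]
  rw [hrad, ← integral_prod_mul]
  congr 1
  refine integral_congr_ae ?_
  filter_upwards [ae_prod_lawQ hQ] with p hp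
  have hmem : p ∈ (fun p : ℝ × (ℤ → E) => toShiftClass (p.1 • p.2)) ⁻¹' {x | u < x.maxNorm} ↔
      u < p.1 := by
    rw [Set.mem_preimage, Set.mem_ofPred_eq, hp.2.2.2]
  by_cases hpu : u < p.1
  · rw [Set.indicator_of_mem (hmem.2 hpu),
      Set.indicator_of_mem (by exact hpu), Pi.one_apply, one_mul,
      ShiftClass.normalize_of_le (by rw [hp.2.2.2]; exact hpu.le), hp.2.2.2,
      toShiftClass_smul _ hp.2.1, ShiftClass.smul_smul', inv_mul_cancel₀ hp.1.ne',
      ShiftClass.one_smul']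
  · rw [Set.indicator_of_notMem (mt hmem.1 hpu),
      Set.indicator_of_notMem (by exact hpu), zero_mul]

end NuStar

end Law

end TailProcess

theorem mainTheorem12
    {E : Type*} [NormedAddCommGroup E] [NormedSpace ℝ E] [FiniteDimensional ℝ E]
    [MeasurableSpace E] [BorelSpace E]
    {Ω : Type*} [MeasurableSpace Ω] (P : Measure Ω) [IsProbabilityMeasure P]
    {Ω' : Type*} [MeasurableSpace Ω'] (P' : Measure Ω') [IsProbabilityMeasure P']
    (X : Ω → ℤ → E) (hX : Measurable X) (hstat : IsStationary P X)
    (ν : Measure (ℤ → E)) (hν : IsTailMeasure P X ν) (hν_supp : ν (ellZero E)ᶜ = 0)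
    (α : ℝ) (hα : 0 < α) (Y : Ω' → ℤ → E) (hY : Measurable Y)
    (hXY : IsTailProcess P X α P' Y)
    (c : ℕ → ℝ) (hc : Tendsto c atTop atTop)
    (r : ℕ → ℕ) (hr : Tendsto r atTop atTop)
    (hrc : Tendsto (fun n => (r n : ℝ) * P.real {ω | c n < ‖X ω 0‖}) atTop (𝓝 0)) :
    TendstoMZero (fun n => clusterMeasure P X (c n) (r n))
        ((nuStar α P' Y).map toShiftClass) ↔
      ∀ u : ℝ, 0 < u →
        Tendsto
            (fun n => P.real {ω | c n * u < seqMax (block (r n) (X ω))} /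
              ((r n : ℝ) * P.real {ω | c n < ‖X ω 0‖}))
            atTop (𝓝 (extremalIndex P' Y * u ^ (-α))) ∧
          TendstoWeakly
            (fun n => (P[|{ω | c n * u < seqMax (block (r n) (X ω))}]).map
              (fun ω => toShiftClass
                ((seqMax (block (r n) (X ω)))⁻¹ • block (r n) (X ω))))
            atTop ((lawQ P' Y).map toShiftClass) := by
  have hl := hXY.ae_mem_ellZero hX hY hν hν_supp
  have hθ : 0 < extremalIndex P' Y := hXY.extremalIndex_pos hX hstat hY hl
  have hprob : IsProbabilityMeasure (lawQ P' Y) :=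
    isProbabilityMeasure_lawQ hY (hXY.measure_past_ne_zero hX hstat hY hl)
  have hprob' : IsProbabilityMeasure ((lawQ P' Y).map (toShiftClass (E := E))) :=
    Measure.isProbabilityMeasure_map measurable_toShiftClass.aemeasurable
  have hQ := ae_lawQ hY hl (hXY.ae_one_lt_norm hY)
  have hfin : ∀ n, BoundedlyFinite (clusterMeasure P X (c n) (r n)) := fun n =>
    boundedlyFinite_clusterMeasure hX (r n) (hXY.measureReal_pos hY (c n))
  have hfin' := boundedlyFinite_map_nuStar hα hQ
  have hcluster : ∀ u > 0, ∀ F : ShiftClass E →ᵇ ℝ, ∀ᶠ n in atTop,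
      ∫ x in {x | u < x.maxNorm}, F (ShiftClass.normalize u x)
          ∂(clusterMeasure P X (c n) (r n)) =
        P.real {ω | c n * u < seqMax (block (r n) (X ω))} /
            ((r n : ℝ) * P.real {ω | c n < ‖X ω 0‖}) *
          ∫ x, F x ∂((P[|{ω | c n * u < seqMax (block (r n) (X ω))}]).map fun ω =>
            toShiftClass ((seqMax (block (r n) (X ω)))⁻¹ • block (r n) (X ω))) :=
    fun u hu F => by
      filter_upwards [hc.eventually_gt_atTop 0] with n hn
      exact setIntegral_clusterMeasure hX hn hu (r n) F
  constructor
  · intro h u hu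
    have hcont : ContinuousAt
        (fun v => ((nuStar α P' Y).map toShiftClass).real {x | v < x.maxNorm}) u := by
      have h1 : ContinuousAt (fun v : ℝ => extremalIndex P' Y * v ^ (-α)) u :=
        (Real.continuousAt_rpow_const _ _ (Or.inl hu.ne')).const_mul _
      refine h1.congr ?_
      filter_upwards [eventually_gt_nhds hu] with v hv
      exact (map_nuStar_real_lt_maxNorm hα hQ hv).symm
    have hlim : ∀ F : ShiftClass E →ᵇ ℝ, Tendsto (fun n =>
        P.real {ω | c n * u < seqMax (block (r n) (X ω))} /
            ((r n : ℝ) * P.real {ω | c n < ‖X ω 0‖}) *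
          ∫ x, F x ∂((P[|{ω | c n * u < seqMax (block (r n) (X ω))}]).map fun ω =>
            toShiftClass ((seqMax (block (r n) (X ω)))⁻¹ • block (r n) (X ω)))) atTop
        (𝓝 (extremalIndex P' Y * u ^ (-α) *
          ∫ x, F x ∂((lawQ P' Y).map toShiftClass))) := fun F => by
      have h1 := h.tendsto_setIntegral hu hcont
        (F.compContinuous ⟨_, ShiftClass.continuous_normalize hu⟩)
      rw [← setIntegral_map_nuStar hα hQ hu F]
      exact h1.congr' (hcluster u hu F)
    have hfirst : Tendsto (fun n => P.real {ω | c n * u < seqMax (block (r n) (X ω))} /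
        ((r n : ℝ) * P.real {ω | c n < ‖X ω 0‖})) atTop
        (𝓝 (extremalIndex P' Y * u ^ (-α))) := by
      have h1 := hlim (BoundedContinuousFunction.const _ 1)
      simp only [BoundedContinuousFunction.const_apply, integral_const, smul_eq_mul, mul_one,
        probReal_univ] at h1
      refine h1.congr fun n => ?_
      have hZ : Measurable fun ω =>
          toShiftClass ((seqMax (block (r n) (X ω)))⁻¹ • block (r n) (X ω)) :=
        measurable_toShiftClass.comp
          (measurable_normalize_seq.comp ((measurable_block (r n)).comp hX))
      by_cases hB : P {ω | c n * u < seqMax (block (r n) (X ω))} = 0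
      · rw [measureReal_def, hB, ENNReal.toReal_zero, zero_div, zero_mul]
      · have := cond_isProbabilityMeasure hB
        have := Measure.isProbabilityMeasure_map (μ := P[|{ω | c n * u <
          seqMax (block (r n) (X ω))}]) hZ.aemeasurable
        rw [probReal_univ, mul_one]
    refine ⟨hfirst, fun F => ?_⟩
    have hpos : 0 < extremalIndex P' Y * u ^ (-α) := mul_pos hθ (Real.rpow_pos_of_pos hu _)
    have h1 := (hlim F).div hfirst hpos.ne'
    rw [mul_div_cancel_left₀ _ hpos.ne'] at h1
    refine h1.congr' ?_
    filter_upwards [hfirst.eventually (lt_mem_nhds hpos)] with n hn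
    exact mul_div_cancel_left₀ _ hn.ne'
  · intro h
    refine tendstoMZero_of_tendsto_setIntegral hfin hfin' ?_ fun u hu F => ?_
    · have h1 := (tendsto_rpow_neg_atTop hα).const_mul (extremalIndex P' Y)
      rw [mul_zero] at h1
      refine h1.congr' ?_
      filter_upwards [eventually_gt_atTop 0] with u hu
      exact (map_nuStar_real_lt_maxNorm hα hQ hu).symm
    · rw [setIntegral_map_nuStar hα hQ hu F]
      exact ((h u hu).1.mul ((h u hu).2 F)).congr' ((hcluster u hu F).mono fun n hn => hn.symm)
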